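/- For each $N\ge 1$ let $E_N$ be a finite set and $(\mathbb P^N_\eta)_{\eta\in E_N}$ an irreducible continuous-time Markov process on the càdlàg path space $D(\mathbb R_+,E_N)$ with generator $(L_Nf)(\eta)=\sum_{\xi\in E_N}\{f(\xi)-f(\eta)\}R_N(\eta,\xi)$ and coordinate process $\eta^N_t$. Fix $\kappa\ge 1$, let $S=\{1,\dots,\kappa\}$, and for each $N$ let $\mathcal E^x_N\subseteq E_N$, $x\in S$, be pairwise disjoint. Set $\mathcal E_N=\bigcup_{x\in S}\mathcal E^x_N$, $\Delta_N=E_N\setminus\mathcal E_N$, and $\Psi_N(\eta)=x$ for $\eta\in\mathcal E^x_N$. For $F\subseteq E_N$ let $\mathcal T^F_t=\int_0^t\mathbf 1\{\eta^N_s\in F\}\,ds$ and $\mathcal S^F_t=\sup\{s\ge 0:\mathcal T^F_s\le t\}$. For a starting point in $\mathcal E_N$, the trace process on $\mathcal E_N$ is $\eta^{\mathcal E_N}_t=\eta^N_{\mathcal S^{\mathcal E_N}_t}$; put $X^N_t=\Psi_N(\eta^{\mathcal E_N}_t)$. Let $(\mathbb Q_x)_{x\in S}$ be a Markov process on $D(\mathbb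 R_+,S)$. The sequence $(\eta^N_t)_{N\ge1}$ is called meta-stable with meta-states $(\mathcal E^x_N)_{x\in S}$ and limit $(\mathbb Q_x)_{x\in S}$ if (A) for every $x\in S$ and every sequence $\eta_N\in\mathcal E^x_N$, $N\ge1$, the law of $X^N$ under $\mathbb P^N_{\eta_N}$ converges weakly to $\mathbb Q_x$ on $D(\mathbb R_+,S)$ with the Skorohod topology; (B) for every $t>0$, $\lim_{N\to\infty}\max_{\eta\in\mathcal E_N}\mathbb E^N_\eta[\mathcal T^{\Delta_N}_t]=0$. For a path started in $\mathcal E_N$ let $\sigma(t)=\sup\{s\le t:\eta^N_s\in\mathcal E_N\}$, and let $\hat X^N_t=\Psi_N(\eta^N_{\sigma(t)})$ if $\eta^N_{\sigma(t)}\in\mathcal E_N$ and $\hat X^N_t=\Psi_N(\eta^N_{\sigma(t)-})$ (left limit) otherwise; that is, $\hat X^N_t$ is the image under $\Psi_N$ of the last point of $\mathcal E_N$ visited up to time $t$. Proposition. If $(\eta^N_t)_{N\ge1}$ is meta-stable with meta-states $(\mathcal E^x_N)_{x\in S}$ and limit $(\mathbb Q_x)_{x\in S}$, then for every $x\in S$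 and every sequence $\eta_N\in\mathcal E^x_N$, $N\ge1$, the law of $\hat X^N$ under $\mathbb P^N_{\eta_N}$ converges weakly to $\mathbb Q_x$ on $D(\mathbb R_+,S)$ with the Skorohod topology. -/

import Mathlib

open MeasureTheory ProbabilityTheory Set Filter Topology
open scoped NNReal ENNReal Uniformity

/-! ### Càdlàg paths and the path space `D(ℝ₊, E)` -/

/-- `f : ℝ₊ → E` is right-continuous with left limits. -/
def IsCadlag {E : Type*} [TopologicalSpace E] (f : ℝ≥0 → E) : Prop :=
  (∀ t, ContinuousWithinAt f (Ici t) t) ∧ ∀ t, ∃ l, Tendsto f (𝓝[<] t) (𝓝 l)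

/-- The path space `D(ℝ₊, E)`. -/
def PathSpace (E : Type*) [TopologicalSpace E] : Type _ := {f : ℝ≥0 → E // IsCadlag f}

namespace PathSpace

section basic

variable {E : Type*} [TopologicalSpace E]

instance : CoeFun (PathSpace E) (fun _ => ℝ≥0 → E) := ⟨Subtype.val⟩

theorem isCadlag_const (x : E) : IsCadlag (fun _ : ℝ≥0 => x) :=
  ⟨fun _ => continuousWithinAt_const, fun _ => ⟨x, tendsto_const_nhds⟩⟩

theorem isCadlag_shift (ω : PathSpace E) (s : ℝ≥0) : IsCadlag (fun t => ω (s + t)) := by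
  refine ⟨fun t => ?_, fun t => ?_⟩
  · have h := ω.2.1 (s + t)
    exact ContinuousWithinAt.comp (t := Ici (s + t)) h (by fun_prop)
      (fun u hu => add_le_add_right hu s)
  · obtain ⟨l, hl⟩ := ω.2.2 (s + t)
    refine ⟨l, hl.comp ?_⟩
    refine tendsto_nhdsWithin_iff.2 ⟨?_, ?_⟩
    · exact ((continuous_const.add continuous_id).tendsto t).mono_left nhdsWithin_le_nhds
    · filter_upwards [self_mem_nhdsWithin] with u hu
      exact (add_lt_add_iff_left s).2 hu

/-- The time shift `(θ_s ω)(t) = ω(s + t)`. -/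
def shift (s : ℝ≥0) (ω : PathSpace E) : PathSpace E := ⟨fun t => ω (s + t), isCadlag_shift ω s⟩

open Classical in
/-- The function `f` as an element of the path space. It is applied below to functions of a path
that are càdlàg almost surely; if `f` is not càdlàg the value is a constant path. -/
noncomputable def ofFun (f : ℝ≥0 → E) : PathSpace E :=
  if h : IsCadlag f then ⟨f, h⟩ else ⟨fun _ => f 0, isCadlag_const _⟩

/-- The σ-algebra on the path space generated by the coordinate maps `ω ↦ ω t`. -/
instance : MeasurableSpace (PathSpace E) :=
  ⨆ t : ℝ≥0, (borel E).comap (fun ω : PathSpace E => ω t)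

/-- The σ-algebra `σ(ω r : r ≤ s)`. -/
abbrev past (E : Type*) [TopologicalSpace E] (s : ℝ≥0) : MeasurableSpace (PathSpace E) :=
  ⨆ r : ℝ≥0, ⨆ _ : r ≤ s, (borel E).comap (fun ω : PathSpace E => ω r)

/-- The pairs of paths `(ω, ω')` for which some time change `l`, an increasing bijection of `ℝ₊`
that is `ε`-close to the identity on `[0, M]`, satisfies `ω' (l t) = ω t` for all `t ≤ M`. -/
def closePairs (E : Type*) [TopologicalSpace E] (M : ℝ≥0) (ε : ℝ) :
    Set (PathSpace E × PathSpace E) :=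
  {p | ∃ l : ℝ≥0 ≃o ℝ≥0, ∀ t ≤ M, |(l t : ℝ) - t| < ε ∧ p.2 (l t) = p.1 t}

theorem closePairs_mono {M M' : ℝ≥0} {ε ε' : ℝ} (hM : M' ≤ M) (hε : ε ≤ ε') :
    closePairs E M ε ⊆ closePairs E M' ε' := by
  rintro p ⟨l, hl⟩
  exact ⟨l, fun t ht => ⟨(hl t (ht.trans hM)).1.trans_le hε, (hl t (ht.trans hM)).2⟩⟩

theorem closePairs_refl (M : ℝ≥0) {ε : ℝ} (hε : 0 < ε) (ω : PathSpace E) :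
    (ω, ω) ∈ closePairs E M ε := ⟨OrderIso.refl _, fun t _ => by simpa using hε⟩

theorem closePairs_symm (M : ℝ≥0) {ε : ℝ} (hε : ε ≤ 1) {p : PathSpace E × PathSpace E}
    (hp : p ∈ closePairs E (M + 1) ε) : p.swap ∈ closePairs E M ε := by
  obtain ⟨l, hl⟩ := hp
  refine ⟨l.symm, fun t ht => ?_⟩
  have h1 : l.symm t ≤ M + 1 := by
    rw [OrderIso.symm_apply_le]
    have := (abs_lt.1 (hl (M + 1) le_rfl).1).1
    push_cast at this
    have ht' : (t : ℝ) ≤ M := by exact_mod_cast ht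
    exact_mod_cast (by linarith : (t : ℝ) ≤ l (M + 1))
  have h2 := hl _ h1
  rw [OrderIso.apply_symm_apply] at h2
  exact ⟨by rw [abs_sub_comm]; exact h2.1, h2.2.symm⟩

theorem closePairs_comp (M : ℝ≥0) {ε : ℝ} (hε : ε ≤ 1) {ω₁ ω₂ ω₃ : PathSpace E}
    (h₁ : (ω₁, ω₂) ∈ closePairs E (M + 1) (ε / 2)) (h₂ : (ω₂, ω₃) ∈ closePairs E (M + 1) (ε / 2)) :
    (ω₁, ω₃) ∈ closePairs E M ε := by
  obtain ⟨l, hl⟩ := h₁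
  obtain ⟨k, hk⟩ := h₂
  refine ⟨l.trans k, fun t ht => ?_⟩
  have ht' : (t : ℝ) ≤ M := by exact_mod_cast ht
  obtain ⟨a1, a2⟩ := hl t (ht.trans (by simp))
  have b : l t ≤ M + 1 := by
    have := (abs_lt.1 a1).2
    exact_mod_cast (by linarith : (l t : ℝ) ≤ M + 1)
  obtain ⟨b1, b2⟩ := hk _ b
  refine ⟨?_, b2.trans a2⟩
  have := abs_add_le ((k (l t) : ℝ) - l t) ((l t : ℝ) - t)
  simp only [OrderIso.trans_apply]
  rw [sub_add_sub_cancel] at this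
  linarith

/-- The sets `closePairs E M ε` form a basis of the Skorohod uniformity. -/
def skorohodBasis (E : Type*) [TopologicalSpace E] : FilterBasis (PathSpace E × PathSpace E) where
  sets := {s | ∃ M : ℝ≥0, ∃ ε : ℝ, 0 < ε ∧ s = closePairs E M ε}
  nonempty := ⟨_, 0, 1, one_pos, rfl⟩
  inter_sets := by
    rintro _ _ ⟨M, ε, hε, rfl⟩ ⟨M', ε', hε', rfl⟩
    exact ⟨_, ⟨max M M', min ε ε', lt_min hε hε', rfl⟩,
      subset_inter (closePairs_mono (le_max_left _ _) (min_le_left _ _))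
        (closePairs_mono (le_max_right _ _) (min_le_right _ _))⟩

/-- The Skorohod (J1) topology on `D(ℝ₊, E)` for a discrete space `E`, together with its natural
uniformity: `ω_n → ω` if and only if there are increasing bijections `l_n` of `ℝ₊` such that, for
every `M`, `sup_{t ≤ M} |l_n t - t| → 0` and `ω_n (l_n t) = ω t` for all `t ≤ M` and all large `n`
(for a discrete `E`, uniform closeness of `ω_n ∘ l_n` to `ω` on `[0, M]` means equality). -/
instance [DiscreteTopology E] : UniformSpace (PathSpace E) :=
  UniformSpace.ofCore <| UniformSpace.Core.mkOfBasis (skorohodBasis E)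
    (by
      rintro _ ⟨M, ε, hε, rfl⟩ ω
      exact closePairs_refl M hε ω)
    (by
      rintro _ ⟨M, ε, hε, rfl⟩
      refine ⟨_, ⟨M + 1, min ε 1, lt_min hε one_pos, rfl⟩, fun p hp => ?_⟩
      exact closePairs_mono le_rfl (min_le_left _ _) (closePairs_symm M (min_le_right _ _) hp))
    (by
      rintro _ ⟨M, ε, hε, rfl⟩
      refine ⟨_, ⟨M + 1, min ε 1 / 2, half_pos (lt_min hε one_pos), rfl⟩, ?_⟩
      rintro ⟨ω₁, ω₃⟩ ⟨ω₂, h₁, h₂⟩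
      exact closePairs_mono le_rfl (min_le_left _ _) (closePairs_comp M (min_le_right _ _) h₁ h₂))

theorem isCadlag_step (m : ℕ) (g : ℕ → E) : IsCadlag (fun t : ℝ≥0 => g ⌊(m : ℝ≥0) * t⌋₊) := by
  have hcont : Continuous fun t : ℝ≥0 => (m : ℝ≥0) * t := by fun_prop
  refine ⟨fun t => ?_, fun t => ?_⟩
  · refine ContinuousWithinAt.congr_of_eventuallyEq
      (continuousWithinAt_const (b := g ⌊(m : ℝ≥0) * t⌋₊)) ?_ rfl
    have h1 : ∀ᶠ s in 𝓝[≥] t, (m : ℝ≥0) * s < (⌊(m : ℝ≥0) * t⌋₊ : ℝ≥0) + 1 :=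
      (hcont.tendsto t).mono_left nhdsWithin_le_nhds (Iio_mem_nhds (Nat.lt_floor_add_one _))
    filter_upwards [h1, self_mem_nhdsWithin] with s hs hs'
    congr 1
    refine (Nat.floor_eq_iff zero_le).2 ⟨?_, hs⟩
    exact (Nat.floor_le zero_le).trans (mul_le_mul_right hs' _)
  · refine ⟨g (⌈(m : ℝ≥0) * t⌉₊ - 1), ?_⟩
    refine tendsto_nhds_of_eventually_eq ?_
    rcases Nat.eq_zero_or_pos m with rfl | hm
    · simp
    rcases eq_or_ne t 0 with rfl | ht
    · simp
    have hpos : 0 < (m : ℝ≥0) * t := mul_pos (by exact_mod_cast hm) (pos_iff_ne_zero.2 ht)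
    have hc1 : 1 ≤ ⌈(m : ℝ≥0) * t⌉₊ := Nat.one_le_iff_ne_zero.2 (Nat.ceil_pos.2 hpos).ne'
    have hlt : ((⌈(m : ℝ≥0) * t⌉₊ - 1 : ℕ) : ℝ≥0) < m * t := Nat.lt_ceil.1 (by omega)
    have h1 : ∀ᶠ s in 𝓝[<] t, ((⌈(m : ℝ≥0) * t⌉₊ - 1 : ℕ) : ℝ≥0) < m * s :=
      (hcont.tendsto t).mono_left nhdsWithin_le_nhds (Ioi_mem_nhds hlt)
    filter_upwards [h1, self_mem_nhdsWithin] with s hs hs'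
    congr 1
    refine (Nat.floor_eq_iff zero_le).2 ⟨hs.le, ?_⟩
    have : (m : ℝ≥0) * s < m * t := mul_lt_mul_of_pos_left hs' (by exact_mod_cast hm)
    have h2 := this.trans_le (Nat.le_ceil _)
    have h3 : ((⌈(m : ℝ≥0) * t⌉₊ - 1 : ℕ) : ℝ≥0) + 1 = (⌈(m : ℝ≥0) * t⌉₊ : ℝ≥0) := by
      exact_mod_cast (by omega : ⌈(m : ℝ≥0) * t⌉₊ - 1 + 1 = ⌈(m : ℝ≥0) * t⌉₊)
    rwa [h3]

/-- The step path with the values `g k` on `[k / m, (k + 1) / m)`, frozen after time `m`. -/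
noncomputable def stepPath (m : ℕ) (g : ℕ → E) : PathSpace E :=
  ⟨fun t => g (min ⌊(m : ℝ≥0) * t⌋₊ (m * m)), isCadlag_step m fun k => g (min k (m * m))⟩

end basic

section borel

variable {E : Type*} [TopologicalSpace E] [DiscreteTopology E]

theorem hasBasis_uniformity :
    (𝓤 (PathSpace E)).HasBasis (fun p : ℝ≥0 × ℝ => 0 < p.2) (fun p => closePairs E p.1 p.2) := by
  refine ⟨fun s => ?_⟩
  refine (skorohodBasis E).mem_filter_iff.trans ⟨?_, ?_⟩
  · rintro ⟨_, ⟨M, ε, hε, rfl⟩, h⟩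
    exact ⟨(M, ε), hε, h⟩
  · rintro ⟨⟨M, ε⟩, hε, h⟩
    exact ⟨_, ⟨M, ε, hε, rfl⟩, h⟩

instance : (𝓤 (PathSpace E)).IsCountablyGenerated := by
  refine HasCountableBasis.isCountablyGenerated (ι := ℕ) (p := fun _ => True)
    (s := fun n => closePairs E n (1 / ((n : ℝ) + 1))) ⟨?_, to_countable _⟩
  refine hasBasis_uniformity.to_hasBasis ?_ ?_
  · rintro ⟨M, ε⟩ hε
    obtain ⟨n, hn⟩ := exists_nat_ge M
    obtain ⟨m, hm⟩ := exists_nat_one_div_lt (show 0 < ε from hε)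
    refine ⟨max n m, trivial, closePairs_mono (hn.trans (by simp)) ?_⟩
    refine le_trans (one_div_le_one_div_of_le (by positivity) ?_) hm.le
    simp
  · intro n _
    exact ⟨(n, 1 / ((n : ℝ) + 1)), by positivity, subset_rfl⟩

/-- Induction along a path with values in a discrete space. -/
theorem cadlag_induction (ω : PathSpace E) {p : ℝ≥0 → Prop} (h0 : p 0)
    (hstep : ∀ a b, a < b → p a → (∀ t, a ≤ t → t < b → ω t = ω a) → p b) (T : ℝ≥0) : p T := by
  by_contra hT
  set A : Set ℝ≥0 := {a | a ≤ T ∧ p a} with hA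
  have hAne : A.Nonempty := ⟨0, zero_le, h0⟩
  have hAb : BddAbove A := ⟨T, fun a ha => ha.1⟩
  have hsT : sSup A ≤ T := csSup_le hAne fun a ha => ha.1
  have hps : p (sSup A) := by
    obtain ⟨l, hl⟩ := ω.2.2 (sSup A)
    by_contra hns
    have hev : ∀ᶠ t in 𝓝[<] (sSup A), ω t = l := by
      exact hl ((isOpen_discrete {l}).mem_nhds rfl)
    obtain ⟨a0, ha0⟩ := hAne
    have hlt : ∀ a ∈ A, a < sSup A := fun a ha =>
      lt_of_le_of_ne (le_csSup hAb ha) (fun h => hns (h ▸ ha.2))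
    obtain ⟨c, hc, hcs⟩ := (mem_nhdsLT_iff_exists_Ioo_subset' (hlt a0 ha0)).1 hev
    obtain ⟨a, ha, hca⟩ := exists_lt_of_lt_csSup ⟨a0, ha0⟩ hc
    refine hns (hstep a _ (hlt a ha) ha.2 fun t h1 h2 => ?_)
    have e1 : ω t = l := hcs ⟨hca.trans_le h1, h2⟩
    have e2 : ω a = l := hcs ⟨hca, hlt a ha⟩
    rw [e1, e2]
  have hlt : sSup A < T := lt_of_le_of_ne hsT (fun h => hT (h ▸ hps))
  have hev : ∀ᶠ t in 𝓝[≥] (sSup A), ω t = ω (sSup A) := by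
    exact ω.2.1 (sSup A) ((isOpen_discrete {ω (sSup A)}).mem_nhds rfl)
  obtain ⟨c, hc, hcs⟩ := (mem_nhdsGE_iff_exists_Ico_subset' hlt).1 hev
  have hmin : sSup A < min c T := lt_min hc hlt
  have : p (min c T) := hstep _ _ hmin hps fun t h1 h2 =>
    hcs ⟨h1, h2.trans_le (min_le_left _ _)⟩
  exact absurd (le_csSup hAb ⟨min_le_right _ _, this⟩) (not_le.2 hmin)

/-- Replace an order isomorphism by an affine map to the right of a point. -/
theorem exists_glue (l : ℝ≥0 ≃o ℝ≥0) (a : ℝ≥0) {c : ℝ≥0} (hc : 0 < c) :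
    ∃ l' : ℝ≥0 ≃o ℝ≥0, (∀ t ≤ a, l' t = l t) ∧ ∀ t, a ≤ t → l' t = l a + c * (t - a) := by
  let f : ℝ≥0 → ℝ≥0 := fun t => if t ≤ a then l t else l a + c * (t - a)
  have f1 : ∀ t ≤ a, f t = l t := fun t ht => if_pos ht
  have f2 : ∀ t, a ≤ t → f t = l a + c * (t - a) := by
    intro t ht
    rcases ht.eq_or_lt with rfl | h
    · simp [f]
    · exact if_neg (not_le.2 h)
  have hmono : StrictMono f := by
    intro s t hst
    rcases le_total t a with h | h
    · rw [f1 t h, f1 s (hst.le.trans h)]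
      exact l.strictMono hst
    · rcases le_total s a with h' | h'
      · rw [f1 s h', f2 t h]
        rcases h.eq_or_lt with rfl | h2
        · simpa using hst
        · exact (l.monotone h').trans_lt (lt_add_of_pos_right _ (mul_pos hc (tsub_pos_of_lt h2)))
      · rw [f2 s h', f2 t h]
        exact add_lt_add_right (mul_lt_mul_of_pos_left (tsub_lt_tsub_right_of_le h' hst) hc) _
  have hsurj : Function.Surjective f := by
    intro y
    rcases le_total y (l a) with h | h
    · refine ⟨l.symm y, ?_⟩
      rw [f1 _ (by rwa [OrderIso.symm_apply_le]), OrderIso.apply_symm_apply]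
    · refine ⟨a + (y - l a) / c, ?_⟩
      rw [f2 _ (by simp), add_tsub_cancel_left, mul_div_cancel₀ _ hc.ne', add_tsub_cancel_of_le h]
  exact ⟨hmono.orderIsoOfSurjective f hsurj, f1, f2⟩

theorem eventually_close_stepPath (ω : PathSpace E) (M : ℝ≥0) {ε : ℝ} (hε : 0 < ε) :
    ∀ᶠ m : ℕ in atTop, (ω, stepPath m fun k => ω (k / m)) ∈ closePairs E M ε := by
  have key : ∀ᶠ m : ℕ in atTop, ∃ l : ℝ≥0 ≃o ℝ≥0, (l (M + 1) : ℝ) = ⌈(m : ℝ≥0) * (M + 1)⌉₊ / m ∧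
      ∀ t < M + 1, (t : ℝ) ≤ l t ∧ (l t : ℝ) ≤ t + 1 / m ∧ ω (⌊(m : ℝ≥0) * l t⌋₊ / m) = ω t := by
    refine cadlag_induction ω (p := fun T => ∀ᶠ m : ℕ in atTop, ∃ l : ℝ≥0 ≃o ℝ≥0,
      (l T : ℝ) = ⌈(m : ℝ≥0) * T⌉₊ / m ∧
      ∀ t < T, (t : ℝ) ≤ l t ∧ (l t : ℝ) ≤ t + 1 / m ∧ ω (⌊(m : ℝ≥0) * l t⌋₊ / m) = ω t) ?_ ?_ _
    · exact Eventually.of_forall fun m => ⟨OrderIso.refl _, by simp, fun t ht => by simp at ht⟩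
    · intro a b hab ha hconst
      have hab' : (0 : ℝ) < (b : ℝ) - a := sub_pos.2 (by exact_mod_cast hab)
      obtain ⟨m₀, hm₀⟩ := exists_nat_gt (1 / ((b : ℝ) - a))
      filter_upwards [ha, eventually_ge_atTop m₀, eventually_gt_atTop 0] with m hm hmm hmpos
      obtain ⟨l, hl, hlt⟩ := hm
      have hmR : (0 : ℝ) < m := by exact_mod_cast hmpos
      have hm1 : 1 < (m : ℝ) * ((b : ℝ) - a) := by
        have : (m₀ : ℝ) ≤ m := by exact_mod_cast hmm
        have := hm₀.trans_le this
        rwa [div_lt_iff₀ hab'] at this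
      set A := ⌈(m : ℝ≥0) * a⌉₊ with hA
      set B := ⌈(m : ℝ≥0) * b⌉₊ with hB
      have hA1 : (m : ℝ) * a ≤ A := by exact_mod_cast Nat.le_ceil ((m : ℝ≥0) * a)
      have hB1 : (m : ℝ) * b ≤ B := by exact_mod_cast Nat.le_ceil ((m : ℝ≥0) * b)
      have hA2 : (A : ℝ) < m * a + 1 := by
        exact_mod_cast Nat.ceil_lt_add_one (zero_le (a := (m : ℝ≥0) * a))
      have hB2 : (B : ℝ) < m * b + 1 := by
        exact_mod_cast Nat.ceil_lt_add_one (zero_le (a := (m : ℝ≥0) * b))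
      have hAB : (A : ℝ) < B := by nlinarith
      have hc : (0 : ℝ) < ((B : ℝ) - A) / m / (b - a) :=
        div_pos (div_pos (by linarith) hmR) hab'
      obtain ⟨l', h1, h2⟩ := exists_glue l a (c := Real.toNNReal (((B : ℝ) - A) / m / (b - a)))
        (Real.toNNReal_pos.2 hc)
      have h2' : ∀ t, a ≤ t → (l' t : ℝ) = A / m + ((B : ℝ) - A) / m / (b - a) * (t - a) := by
        intro t ht
        rw [h2 t ht]
        rw [NNReal.coe_add, NNReal.coe_mul, NNReal.coe_sub ht, hl, Real.coe_toNNReal _ hc.le]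
      have hlb : (l' b : ℝ) = B / m := by
        rw [h2' b hab.le]
        field_simp
        ring
      refine ⟨l', hlb, fun t ht => ?_⟩
      rcases lt_or_ge t a with hta | hta
      · rw [h1 t hta.le]
        exact hlt t hta
      · have hta' : (a : ℝ) ≤ t := by exact_mod_cast hta
        have htb' : (t : ℝ) < b := by exact_mod_cast ht
        set θ : ℝ := ((t : ℝ) - a) / (b - a) with hθ
        have θ0 : 0 ≤ θ := div_nonneg (by linarith) hab'.le
        have θ1 : θ ≤ 1 := (div_le_one hab').2 (by linarith)
        have hθt : (t : ℝ) = a + θ * (b - a) := by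
          rw [hθ]; field_simp; ring
        have hlθ : (m : ℝ) * l' t = A + θ * (B - A) := by
          rw [h2' t hta, hθ]; field_simp
        have g1 : (m : ℝ) * t ≤ m * l' t := by rw [hlθ, hθt]; nlinarith
        have g2 : (m : ℝ) * l' t ≤ m * t + 1 := by rw [hlθ, hθt]; nlinarith
        refine ⟨le_of_mul_le_mul_left g1 hmR, ?_, ?_⟩
        · refine le_of_mul_le_mul_left (g2.trans_eq ?_) hmR
          field_simp
        · set k := ⌊(m : ℝ≥0) * l' t⌋₊ with hk
          have k1 : A ≤ k := by
            refine Nat.le_floor ?_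
            have : (A : ℝ) ≤ m * l' t := by rw [hlθ]; nlinarith
            exact_mod_cast this
          have k2 : k < B := by
            refine (Nat.floor_lt zero_le).2 ?_
            have h3 : (l' t : ℝ) < B / m := by
              rw [← hlb]
              exact_mod_cast l'.strictMono ht
            rw [lt_div_iff₀ hmR, mul_comm] at h3
            exact_mod_cast h3
          have hm' : (0 : ℝ≥0) < m := by exact_mod_cast hmpos
          rw [hconst t hta ht]
          refine hconst _ ?_ ?_
          · rw [le_div_iff₀ hm', mul_comm]
            exact (Nat.ceil_le.1 k1)
          · rw [div_lt_iff₀ hm', mul_comm]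
            exact Nat.lt_ceil.1 k2
  obtain ⟨m₁, hm₁⟩ := exists_nat_gt (1 / ε)
  obtain ⟨m₂, hm₂⟩ := exists_nat_ge (M + 1)
  filter_upwards [key, eventually_ge_atTop m₁, eventually_ge_atTop (m₂ + 1),
    eventually_gt_atTop 0] with m hm h1 h2 h3
  obtain ⟨l, -, hl⟩ := hm
  have hmR : (0 : ℝ) < m := by exact_mod_cast h3
  have hmε : 1 / (m : ℝ) < ε := by
    rw [div_lt_comm₀ hmR hε]
    exact hm₁.trans_le (by exact_mod_cast h1)
  refine ⟨l, fun t ht => ?_⟩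
  have htM : t < M + 1 := ht.trans_lt (by simp)
  obtain ⟨a1, a2, a3⟩ := hl t htM
  refine ⟨by rw [abs_lt]; constructor <;> linarith, ?_⟩
  have hle : ⌊(m : ℝ≥0) * l t⌋₊ ≤ m * m := by
    have : (l t : ℝ) ≤ m := by
      have b1 : (t : ℝ) ≤ M := by exact_mod_cast ht
      have b2 : (M : ℝ) + 1 ≤ m₂ := by exact_mod_cast hm₂
      have b3 : (m₂ : ℝ) + 1 ≤ m := by exact_mod_cast h2
      have b4 : 1 / (m : ℝ) ≤ 1 := by
        rw [div_le_one hmR]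
        exact_mod_cast h3
      linarith
    have h5 : (m : ℝ≥0) * l t ≤ ((m * m : ℕ) : ℝ≥0) := by
      push_cast
      exact mul_le_mul_right (by exact_mod_cast this) _
    exact Nat.floor_le_of_le h5
  change ω ((min ⌊(m : ℝ≥0) * l t⌋₊ (m * m) : ℕ) / m) = ω t
  rw [min_eq_left hle]
  exact a3

theorem tendsto_stepPath (ω : PathSpace E) :
    Tendsto (fun m : ℕ => stepPath m fun k => ω (k / m)) atTop (𝓝 ω) := by
  rw [(nhds_basis_uniformity' hasBasis_uniformity).tendsto_right_iff]
  rintro ⟨M, ε⟩ hε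
  exact eventually_close_stepPath ω M hε

theorem measurableSet_eval (t : ℝ≥0) (s : Set E) :
    MeasurableSet {ω : PathSpace E | ω t ∈ s} := by
  refine (le_iSup (fun t : ℝ≥0 => (borel E).comap (fun ω : PathSpace E => ω t)) t) _ ?_
  exact ⟨s, by rw [borel_eq_top_of_discrete]; trivial, rfl⟩

/-- For countable discrete `E`, Skorohod-open sets belong to the σ-algebra of the coordinates. -/
instance [Countable E] : OpensMeasurableSpace (PathSpace E) := by
  let _ : PseudoMetricSpace (PathSpace E) := UniformSpace.pseudoMetricSpace _
  have hmeas : ∀ (m : ℕ) (U : Set (PathSpace E)),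
      MeasurableSet {ω : PathSpace E | stepPath m (fun k => ω (k / m)) ∈ U} := by
    intro m U
    let r : (Fin (m * m + 1) → E) → PathSpace E :=
      fun x => stepPath m fun k => x ⟨min k (m * m), by omega⟩
    have hr : ∀ ω : PathSpace E, stepPath m (fun k => ω (k / m)) =
        r fun i => ω ((i : ℕ) / m) := by
      intro ω
      apply Subtype.ext
      funext t
      simp [r, stepPath]
    have : {ω : PathSpace E | stepPath m (fun k => ω (k / m)) ∈ U} =
        ⋃ x ∈ r ⁻¹' U, ⋂ i : Fin (m * m + 1), {ω : PathSpace E | ω ((i : ℕ) / m) ∈ ({x i} : Set E)} := by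
      ext ω
      simp only [hr, mem_ofPred_eq, mem_iUnion, mem_iInter, mem_preimage, mem_singleton_iff,
        exists_prop]
      constructor
      · exact fun h => ⟨_, h, fun i => rfl⟩
      · rintro ⟨x, hx, h⟩
        rwa [show (fun i : Fin (m * m + 1) => ω ((i : ℕ) / m)) = x from funext h]
    rw [this]
    exact MeasurableSet.biUnion (to_countable _) fun x _ =>
      MeasurableSet.iInter fun i => measurableSet_eval _ _
  refine ⟨borel_eq_generateFrom_isClosed.le.trans (MeasurableSpace.generateFrom_le ?_)⟩
  intro C hC
  have hf : Measurable fun ω : PathSpace E => Metric.infEDist ω C := by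
    refine measurable_of_tendsto_metrizable
      (f := fun m ω => Metric.infEDist (stepPath m fun k => ω (k / m)) C) (fun m => ?_) ?_
    · intro s _
      exact hmeas m ((fun ω => Metric.infEDist ω C) ⁻¹' s)
    · rw [tendsto_pi_nhds]
      intro ω
      exact (Metric.continuous_infEDist.tendsto ω).comp (tendsto_stepPath ω)
  have : C = (fun ω : PathSpace E => Metric.infEDist ω C) ⁻¹' {0} := by
    ext ω
    exact Metric.mem_iff_infEDist_zero_of_closed hC
  rw [this]
  exact hf (measurableSet_singleton 0)

end borel

end PathSpace

open PathSpace

/-! ### Markov processes -/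

/-- `(P x)_{x ∈ E}` is a (time-homogeneous) Markov process on `D(ℝ₊, E)`: `P x` is the law of the
process started at `x`, and for `A ∈ σ(ω r : r ≤ s)` and every event `B`,
`P x (A ∩ θ_s⁻¹ B) = ∫_A P (ω s) B dP x`. -/
structure IsMarkovProcess {E : Type*} [TopologicalSpace E]
    (P : E → ProbabilityMeasure (PathSpace E)) : Prop where
  start : ∀ x, ∀ᵐ ω ∂(P x : Measure (PathSpace E)), ω 0 = x
  markov : ∀ (x : E) (s : ℝ≥0) (A B : Set (PathSpace E)),
    MeasurableSet[past E s] A → MeasurableSet B →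
    (P x : Measure (PathSpace E)) (A ∩ shift s ⁻¹' B) =
      ∫⁻ ω in A, (P (ω s) : Measure (PathSpace E)) B ∂(P x : Measure (PathSpace E))

/-- `(P η)_{η ∈ E}` has the generator `(L f) η = ∑ ξ, (f ξ - f η) R η ξ`: for every `f : E → ℝ`,
`L f` is the derivative at `t = 0` (from the right) of `t ↦ 𝔼_η [f (η_t)]`. -/
def HasJumpRates {E : Type*} [TopologicalSpace E] [Fintype E]
    (R : E → E → ℝ≥0) (P : E → ProbabilityMeasure (PathSpace E)) : Prop :=
  ∀ (f : E → ℝ) (η : E),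
    HasDerivWithinAt (fun t : ℝ => ∫ ω, f (ω t.toNNReal) ∂(P η : Measure (PathSpace E)))
      (∑ ξ, (f ξ - f η) * (R η ξ : ℝ)) (Ici 0) 0

/-- Every state can be reached from every other one through jumps of positive rate. -/
def IsIrreducibleRates {E : Type*} (R : E → E → ℝ≥0) : Prop :=
  ∀ η ξ, Relation.ReflTransGen (fun a b => 0 < R a b) η ξ

open Classical in
/-- The projection `Ψ` that maps the points of `𝓔 x` to `x`. Its value outside of `⋃ x, 𝓔 x` is
irrelevant. -/
noncomputable def metaProj {κ : ℕ} [NeZero κ] {E : Type*} (𝓔 : Fin κ → Set E) (η : E) : Fin κ :=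
  if h : ∃ x, η ∈ 𝓔 x then h.choose else 0

/-! ### Trace and last-visit processes -/

section paths

variable {E : Type*} [TopologicalSpace E]

/-- The time `𝓣^F_t(ω) = ∫₀ᵗ 𝟏{ω s ∈ F} ds` spent in `F` during `[0, t]`. -/
noncomputable def occupationTime (F : Set E) (t : ℝ≥0) (ω : PathSpace E) : ℝ≥0∞ :=
  ∫⁻ s in Icc (0 : ℝ) t, F.indicator 1 (ω s.toNNReal)

/-- The generalized inverse `𝓢^F_t(ω) = sup {s ≥ 0 : 𝓣^F_s(ω) ≤ t}`. -/
noncomputable def inverseOccupationTime (F : Set E) (t : ℝ≥0) (ω : PathSpace E) : ℝ≥0 :=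
  sSup {s : ℝ≥0 | occupationTime F s ω ≤ t}

/-- The trace `t ↦ ω (𝓢^F_t)` of the path `ω` on `F`. -/
noncomputable def tracePath (F : Set E) (ω : PathSpace E) (t : ℝ≥0) : E :=
  ω (inverseOccupationTime F t ω)

/-- The last time `σ(t) = sup {s ≤ t : ω s ∈ F}` before `t` at which `ω` is in `F`. -/
noncomputable def lastTime (F : Set E) (ω : PathSpace E) (t : ℝ≥0) : ℝ≥0 :=
  sSup {s : ℝ≥0 | s ≤ t ∧ ω s ∈ F}

open Classical in
/-- The last point of `F` visited by `ω` up to time `t`: it is `ω (σ(t))` if the supremum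
defining `σ(t)` is attained, and the left limit `ω (σ(t)-)` otherwise. -/
noncomputable def lastVisit (F : Set E) (ω : PathSpace E) (t : ℝ≥0) : E :=
  if ω (lastTime F ω t) ∈ F then ω (lastTime F ω t) else Function.leftLim ω (lastTime F ω t)

variable {κ : ℕ} [NeZero κ]

/-- The path of `X_t = Ψ(η^𝓔_t)`, where `η^𝓔` is the trace of `η` on `⋃ x, 𝓔 x`. -/
noncomputable def traceProcess (𝓔 : Fin κ → Set E) (ω : PathSpace E) : PathSpace (Fin κ) :=
  ofFun fun t => metaProj 𝓔 (tracePath (⋃ x, 𝓔 x) ω t)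

/-- The path of `X̂_t`, the image under `Ψ` of the last point of `⋃ x, 𝓔 x` visited up to `t`. -/
noncomputable def lastVisitProcess (𝓔 : Fin κ → Set E) (ω : PathSpace E) : PathSpace (Fin κ) :=
  ofFun fun t => metaProj 𝓔 (lastVisit (⋃ x, 𝓔 x) ω t)

end paths

/-! ### Meta-stability -/

/-- The sequence of Markov processes `(P N)` is meta-stable with meta-states `𝓔 N x` and limit the
Markov process `(Q x)`. -/
structure IsMetastable {κ : ℕ} [NeZero κ] {E : ℕ → Type*} [∀ N, TopologicalSpace (E N)]
    (P : ∀ N, E N → ProbabilityMeasure (PathSpace (E N))) (𝓔 : ∀ N, Fin κ → Set (E N))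
    (Q : Fin κ → ProbabilityMeasure (PathSpace (Fin κ))) : Prop where
  isMarkovProcess_limit : IsMarkovProcess Q
  tendsto_trace : ∀ (x : Fin κ) (η : ∀ N, E N), (∀ N, η N ∈ 𝓔 N x) →
    TendstoInDistribution (fun N => traceProcess (𝓔 N)) atTop id
      (fun N => (P N (η N) : Measure (PathSpace (E N)))) (Q x : Measure (PathSpace (Fin κ)))
  tendsto_occupationTime : ∀ t : ℝ≥0, 0 < t →
    Tendsto (fun N => ⨆ η ∈ ⋃ x, 𝓔 N x,
      ∫⁻ ω, occupationTime (⋃ x, 𝓔 N x)ᶜ t ω ∂(P N η : Measure (PathSpace (E N)))) atTop (𝓝 0)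

/-!
The last-visit path is the trace path run on a slower clock: if the path stays at a point of `F`
during `[a, b)` and then outside of `F` during `[b, T)`, the trace waits there only for the time
`b - a`, while the last-visit path waits until `T`. Stretching each such sojourn over the excursion
that follows it is a time change carrying the trace onto the last-visit path, and it displaces the
instants before `T` by at most the time spent outside of `F` during `[0, T]`. By condition (B) this
time vanishes in probability, so the Skorohod distance between the two processes does too, and
they have the same limit in distribution.

The trace is defined at all times because the total time spent in `F` is almost surely infinite: if
it were finite, the time remaining after `t` would tend to `0` as `t → ∞`, whereas, by
irreducibility and finiteness of the state space, a small total time has small probability uniformly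
in the starting point, and hence, by the Markov property, in `t`.
-/

/-! ### Càdlàg paths -/

section cadlagPaths

variable {E E' : Type*} [TopologicalSpace E] [TopologicalSpace E']

theorem ofFun_apply {f : ℝ≥0 → E} (hf : IsCadlag f) (t : ℝ≥0) : ofFun f t = f t :=
  congrArg (fun ω : PathSpace E => ω t) (dif_pos hf)

theorem IsCadlag.comp_orderIso {f : ℝ≥0 → E} (hf : IsCadlag f) (l : ℝ≥0 ≃o ℝ≥0) :
    IsCadlag (f ∘ l) := by
  refine ⟨fun t => (hf.1 (l t)).comp l.continuous.continuousWithinAt fun s hs => l.monotone hs,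
    fun t => ?_⟩
  obtain ⟨v, hv⟩ := hf.2 (l t)
  exact ⟨v, hv.comp (l.continuous.continuousWithinAt.tendsto_nhdsWithin
    fun s hs => l.strictMono hs)⟩

theorem IsCadlag.of_eventuallyEq {f : ℝ≥0 → E} (h : ∀ t, ∃ g, IsCadlag g ∧ f =ᶠ[𝓝 t] g) :
    IsCadlag f := by
  refine ⟨fun t => ?_, fun t => ?_⟩ <;> obtain ⟨g, hg, hfg⟩ := h t
  · exact (hg.1 t).congr_of_eventuallyEq (hfg.filter_mono nhdsWithin_le_nhds) hfg.self_of_nhds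
  · obtain ⟨v, hv⟩ := hg.2 t
    exact ⟨v, hv.congr' (hfg.filter_mono nhdsWithin_le_nhds).symm⟩

theorem PathSpace.measurable_of_eval {Ω : Type*} [MeasurableSpace Ω] {Y : Ω → PathSpace E}
    (h : ∀ t (s : Set E), MeasurableSet {a | Y a t ∈ s}) : Measurable Y := by
  refine Measurable.of_comap_le ?_
  rw [instMeasurableSpace, MeasurableSpace.comap_iSup]
  refine iSup_le fun t => ?_
  rw [MeasurableSpace.comap_comp]
  rintro _ ⟨s, -, rfl⟩
  exact h t s

variable [DiscreteTopology E]

theorem PathSpace.exists_forall_Ico_eq (ω : PathSpace E) (t : ℝ≥0) :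
    ∃ c, t < c ∧ ∀ s ∈ Ico t c, ω s = ω t :=
  (mem_nhdsGE_iff_exists_Ico_subset' (lt_add_one t)).1 <|
    (ω.2.1 t).eventually_mem ((isOpen_discrete {ω t}).mem_nhds rfl)

theorem IsCadlag.of_forall_eqOn_Icc {g : ℝ≥0 → E} (hg : IsCadlag g) {f : ℝ≥0 → E'}
    (h : ∀ a b, a ≤ b → (∀ s ∈ Icc a b, g s = g a) → f b = f a) : IsCadlag f := by
  refine ⟨fun t => ?_, fun t => ?_⟩
  · obtain ⟨c, hc, hgc⟩ := PathSpace.exists_forall_Ico_eq ⟨g, hg⟩ t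
    refine tendsto_nhds_of_eventually_eq ?_
    filter_upwards [Ico_mem_nhdsGE hc] with s hs
    exact h t s hs.1 fun r hr => hgc r ⟨hr.1, hr.2.trans_lt hs.2⟩
  · rcases eq_zero_or_pos t with rfl | ht
    · exact ⟨f 0, by simp⟩
    obtain ⟨v, hv⟩ := hg.2 t
    obtain ⟨c, hct, hgc⟩ := (mem_nhdsLT_iff_exists_Ioo_subset' ht).1
      (hv ((isOpen_discrete {v}).mem_nhds rfl))
    obtain ⟨d, hcd, hdt⟩ := exists_between (show c < t from hct)
    have hgd : ∀ s ∈ Ico d t, g s = v := fun s hs => hgc ⟨hcd.trans_le hs.1, hs.2⟩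
    refine ⟨f d, tendsto_nhds_of_eventually_eq ?_⟩
    filter_upwards [Ico_mem_nhdsLT hdt] with s hs
    refine h d s hs.1 fun r hr => ?_
    rw [hgd r ⟨hr.1, hr.2.trans_lt hs.2⟩, hgd d ⟨le_rfl, hdt⟩]

theorem IsCadlag.comp_discrete {f : ℝ≥0 → E} (hf : IsCadlag f) (Ψ : E → E') :
    IsCadlag fun t => Ψ (f t) :=
  hf.of_forall_eqOn_Icc fun _ b hab h => congrArg Ψ (h b ⟨hab, le_rfl⟩)

theorem PathSpace.eval_mem_iff_dense (ω : PathSpace E) (F : Set E) {D : Set ℝ≥0} (hD : Dense D)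
    (s : ℝ≥0) : ω s ∈ F ↔ ∃ q ∈ D, s < q ∧ ∀ r ∈ D, s < r → r < q → ω r ∈ F := by
  obtain ⟨c, hc, hωc⟩ := ω.exists_forall_Ico_eq s
  constructor
  · intro hs
    obtain ⟨q, hqD, hsq, hqc⟩ := hD.exists_between hc
    exact ⟨q, hqD, hsq, fun r _ hsr hrq => (hωc r ⟨hsr.le, hrq.trans hqc⟩).symm ▸ hs⟩
  · rintro ⟨q, -, hsq, hq⟩
    obtain ⟨r, hrD, hsr, hr⟩ := hD.exists_between (lt_min hsq hc)
    rw [← hωc r ⟨hsr.le, hr.trans_le (min_le_right _ _)⟩]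
    exact hq r hrD hsr (hr.trans_le (min_le_left _ _))

theorem PathSpace.measurableSet_eval_prod (F : Set E) :
    MeasurableSet {p : PathSpace E × ℝ≥0 | p.1 p.2 ∈ F} := by
  obtain ⟨D, hDc, hD⟩ := TopologicalSpace.exists_countable_dense ℝ≥0
  have hset : {p : PathSpace E × ℝ≥0 | p.1 p.2 ∈ F} = ⋃ q ∈ D, {p | p.2 < q} ∩
      ⋂ r ∈ D, {p | p.2 < r ∧ r < q}ᶜ ∪ Prod.fst ⁻¹' {ω | ω r ∈ F} := by
    ext p
    simp only [mem_ofPred_eq, p.1.eval_mem_iff_dense F hD p.2, mem_iUnion, mem_iInter,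
      mem_inter_iff, mem_union, mem_compl_iff, mem_preimage, exists_prop, ← imp_iff_not_or, and_imp]
  rw [hset]
  refine MeasurableSet.biUnion hDc fun q _ => ?_
  refine (measurableSet_lt measurable_snd measurable_const).inter ?_
  refine MeasurableSet.biInter hDc fun r _ => ?_
  exact (measurable_snd measurableSet_Iio |>.inter (.const _)).compl.union
    (measurable_fst (measurableSet_eval r F))

end cadlagPaths

/-! ### Occupation times -/

section occupationTime

variable {E : Type*} [TopologicalSpace E] (F : Set E) (ω : PathSpace E)

theorem occupationTime_add (s t : ℝ≥0) :
    occupationTime F (s + t) ω = occupationTime F s ω + occupationTime F t (shift s ω) := by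
  have hIcc : Icc (0 : ℝ) (s + t : ℝ≥0) = Icc (0 : ℝ) s ∪ Ioc (s : ℝ) (s + t) := by
    rw [NNReal.coe_add, Icc_union_Ioc_eq_Icc s.coe_nonneg (by simp)]
  have hdisj : Disjoint (Icc (0 : ℝ) s) (Ioc (s : ℝ) (s + t)) :=
    disjoint_left.2 fun u hu hu' => hu'.1.not_ge hu.2
  have hshift : ∫⁻ u in Ioc (s : ℝ) (s + t), F.indicator (1 : E → ℝ≥0∞) (ω u.toNNReal) =
      occupationTime F t (shift s ω) := by
    rw [occupationTime, ← setLIntegral_congr Ioc_ae_eq_Icc,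
      ← (measurePreserving_add_left volume (s : ℝ)).setLIntegral_comp_preimage_emb
        (measurableEmbedding_addLeft _), preimage_const_add_Ioc, sub_self, add_sub_cancel_left]
    refine setLIntegral_congr_fun measurableSet_Ioc fun u hu => ?_
    simp only [Real.toNNReal_add s.coe_nonneg hu.1.le, Real.toNNReal_coe, shift]
  rw [occupationTime, hIcc, lintegral_union measurableSet_Ioc hdisj, hshift]
  rfl

theorem occupationTime_mono : Monotone fun t => occupationTime F t ω := by
  intro s t hst
  obtain ⟨u, rfl⟩ := exists_add_of_le hst
  exact le_self_add.trans_eq (occupationTime_add F ω s u).symm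

theorem occupationTime_le (t : ℝ≥0) : occupationTime F t ω ≤ t :=
  calc occupationTime F t ω ≤ ∫⁻ _ in Icc (0 : ℝ) t, 1 :=
        lintegral_mono fun _ => indicator_le_self _ _ _
    _ = t := by simp

variable {F ω} in
theorem occupationTime_eq_zero {t : ℝ≥0} (h : ∀ s < t, ω s ∉ F) : occupationTime F t ω = 0 := by
  rw [occupationTime, ← setLIntegral_congr Ico_ae_eq_Icc]
  refine (setLIntegral_congr_fun measurableSet_Ico fun s hs => ?_).trans lintegral_zero
  exact indicator_of_notMem (h _ ((Real.toNNReal_lt_iff_lt_coe hs.1).2 hs.2)) _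

theorem measurable_indicator_eval [DiscreteTopology E] :
    Measurable fun p : PathSpace E × ℝ => F.indicator (1 : E → ℝ≥0∞) (p.1 p.2.toNNReal) :=
  (measurable_one.indicator (measurableSet_eval_prod F)).comp
    (measurable_fst.prodMk measurable_snd.real_toNNReal)

theorem measurable_occupationTime [DiscreteTopology E] (t : ℝ≥0) :
    Measurable fun ω : PathSpace E => occupationTime F t ω :=
  (measurable_indicator_eval F).lintegral_prod_right'

theorem occupationTime_add_compl [DiscreteTopology E] (t : ℝ≥0) :
    occupationTime F t ω + occupationTime Fᶜ t ω = t := by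
  have hmeas : Measurable fun s : ℝ => F.indicator (1 : E → ℝ≥0∞) (ω s.toNNReal) :=
    (measurable_indicator_eval F).comp measurable_prodMk_left
  rw [occupationTime, occupationTime, ← lintegral_add_left hmeas]
  simp only [indicator_self_add_compl_apply]
  simp

/-- The occupation time of `F`, which is at most `t`, as a nonnegative real number. -/
noncomputable def timeIn (t : ℝ≥0) : ℝ≥0 :=
  (occupationTime F t ω).toNNReal

theorem coe_timeIn (t : ℝ≥0) : (timeIn F ω t : ℝ≥0∞) = occupationTime F t ω :=
  ENNReal.coe_toNNReal (ne_top_of_le_ne_top ENNReal.coe_ne_top (occupationTime_le F ω t))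

theorem timeIn_le (t : ℝ≥0) : timeIn F ω t ≤ t := by
  exact_mod_cast (coe_timeIn F ω t).trans_le (occupationTime_le F ω t)

theorem timeIn_zero : timeIn F ω 0 = 0 :=
  le_zero_iff.1 (timeIn_le F ω 0)

theorem timeIn_mono : Monotone (timeIn F ω) := fun s t hst => by
  rw [← ENNReal.coe_le_coe, coe_timeIn, coe_timeIn]
  exact occupationTime_mono F ω hst

variable {F ω} {a b : ℝ≥0}

theorem timeIn_of_notMem (hab : a ≤ b) (h : ∀ s ∈ Ico a b, ω s ∉ F) :
    timeIn F ω b = timeIn F ω a := by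
  obtain ⟨u, rfl⟩ := exists_add_of_le hab
  have hzero : occupationTime F u (shift a ω) = 0 :=
    occupationTime_eq_zero fun s hs => h _ ⟨le_self_add, add_lt_add_right hs a⟩
  rw [timeIn, occupationTime_add, hzero, add_zero, timeIn]

variable (F ω) in
/-- The total time spent in `F` by a path. The trace on `F` of a path is only meaningful at all
times if its total occupation time of `F` is infinite. -/
noncomputable def totalOccupationTime : ℝ≥0∞ := ⨆ t : ℝ≥0, occupationTime F t ω

theorem exists_lt_timeIn_of_totalOccupationTime_eq_top (h : totalOccupationTime F ω = ∞)
    (t : ℝ≥0) : ∃ T, t < timeIn F ω T := by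
  obtain ⟨T, hT⟩ := lt_iSup_iff.1 (ENNReal.coe_lt_top.trans_eq h.symm : (t : ℝ≥0∞) < _)
  exact ⟨T, ENNReal.coe_lt_coe.1 (hT.trans_eq (coe_timeIn F ω T).symm)⟩

theorem totalOccupationTime_eq_add_shift (s : ℝ≥0) :
    totalOccupationTime F ω = occupationTime F s ω + totalOccupationTime F (shift s ω) := by
  have hsup : ⨆ t, occupationTime F (s + t) ω = totalOccupationTime F ω :=
    (occupationTime_mono F ω).iSup_comp_eq fun t => ⟨t, le_add_self⟩
  rw [← hsup]
  simp only [occupationTime_add, totalOccupationTime, ENNReal.add_iSup]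

theorem totalOccupationTime_shift_le (s : ℝ≥0) :
    totalOccupationTime F (shift s ω) ≤ totalOccupationTime F ω :=
  le_add_self.trans_eq (totalOccupationTime_eq_add_shift s).symm

theorem antitone_totalOccupationTime_shift (F : Set E) (ω : PathSpace E) :
    Antitone fun s => totalOccupationTime F (shift s ω) := by
  intro s t hst
  obtain ⟨u, rfl⟩ := exists_add_of_le hst
  have hshift : shift (s + u) ω = shift u (shift s ω) :=
    Subtype.ext (funext fun r => congrArg ω.1 (add_assoc s u r))
  simp only [hshift]
  exact totalOccupationTime_shift_le u

theorem exists_totalOccupationTime_shift_lt (h : totalOccupationTime F ω ≠ ∞) {δ : ℝ≥0∞}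
    (hδ : 0 < δ) : ∃ t : ℝ≥0, totalOccupationTime F (shift t ω) < δ := by
  by_contra! hle
  have hadd (t : ℝ≥0) : occupationTime F t ω + δ ≤ totalOccupationTime F ω :=
    (add_le_add_right (hle t) _).trans_eq (totalOccupationTime_eq_add_shift t).symm
  have hsup : totalOccupationTime F ω + δ ≤ totalOccupationTime F ω := by
    rw [totalOccupationTime, ENNReal.iSup_add]
    exact iSup_le hadd
  exact hsup.not_gt (ENNReal.lt_add_right h hδ.ne')

variable [DiscreteTopology E]

theorem timeIn_add_compl (F : Set E) (ω : PathSpace E) (t : ℝ≥0) :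
    timeIn F ω t + timeIn Fᶜ ω t = t := by
  have := occupationTime_add_compl F ω t
  rw [← coe_timeIn, ← coe_timeIn] at this
  exact_mod_cast this

theorem timeIn_of_mem (hab : a ≤ b) (h : ∀ s ∈ Ico a b, ω s ∈ F) :
    timeIn F ω b = timeIn F ω a + (b - a) := by
  have hcompl : timeIn Fᶜ ω b = timeIn Fᶜ ω a :=
    timeIn_of_notMem hab fun s hs => not_not.2 (h s hs)
  rw [← add_left_inj (timeIn Fᶜ ω b), timeIn_add_compl, hcompl, add_right_comm, timeIn_add_compl,
    add_tsub_cancel_of_le hab]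

theorem timeIn_lt_of_mem (hab : a < b) (h : ω a ∈ F) : timeIn F ω a < timeIn F ω b := by
  obtain ⟨c, hc, hωc⟩ := ω.exists_forall_Ico_eq a
  have hac : a < min b c := lt_min hab hc
  calc timeIn F ω a < timeIn F ω a + (min b c - a) := lt_add_of_pos_right _ (tsub_pos_of_lt hac)
    _ = timeIn F ω (min b c) := (timeIn_of_mem hac.le fun s hs =>
        (hωc s ⟨hs.1, hs.2.trans_le (min_le_right _ _)⟩).symm ▸ h).symm
    _ ≤ timeIn F ω b := timeIn_mono F ω (min_le_left _ _)

theorem inverseOccupationTime_timeIn (h : ω a ∈ F) :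
    inverseOccupationTime F (timeIn F ω a) ω = a := by
  refine IsGreatest.csSup_eq ⟨(coe_timeIn F ω a).ge, fun b hb => ?_⟩
  by_contra! hab
  have hle : timeIn F ω b ≤ timeIn F ω a := by
    rw [← ENNReal.coe_le_coe, coe_timeIn]
    exact hb
  exact hle.not_gt (timeIn_lt_of_mem hab h)

theorem tracePath_timeIn (h : ω a ∈ F) : tracePath F ω (timeIn F ω a) = ω a := by
  rw [tracePath, inverseOccupationTime_timeIn h]

theorem totalOccupationTime_pos {s : ℝ≥0} (h : ω s ∈ F) : 0 < totalOccupationTime F ω :=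
  calc (0 : ℝ≥0∞) < timeIn F ω (s + 1) := ENNReal.coe_pos.2 <|
        zero_le.trans_lt (timeIn_lt_of_mem (lt_add_one s) h)
    _ = occupationTime F (s + 1) ω := coe_timeIn F ω (s + 1)
    _ ≤ totalOccupationTime F ω := le_iSup (fun t => occupationTime F t ω) (s + 1)

theorem measurable_totalOccupationTime (F : Set E) :
    Measurable fun ω : PathSpace E => totalOccupationTime F ω := by
  have hsup (ω : PathSpace E) : totalOccupationTime F ω = ⨆ n : ℕ, occupationTime F n ω :=
    ((occupationTime_mono F ω).iSup_comp_eq exists_nat_ge).symm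
  simp only [hsup]
  exact Measurable.iSup fun n => measurable_occupationTime F n

end occupationTime

/-! ### The last-visit path -/

section lastVisit

variable {E : Type*} [TopologicalSpace E] {F : Set E} {ω : PathSpace E} {a b t T : ℝ≥0}

theorem lastTime_eq_self (h : ω t ∈ F) : lastTime F ω t = t :=
  IsGreatest.csSup_eq ⟨⟨le_rfl, h⟩, fun _ hs => hs.1⟩

theorem lastVisit_eq_self (h : ω t ∈ F) : lastVisit F ω t = ω t := by
  rw [lastVisit, lastTime_eq_self h, if_pos h]

theorem lastVisit_eq_of_forall_notMem (hab : a ≤ b) (h : ∀ s ∈ Icc a b, ω s ∉ F) :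
    lastVisit F ω b = lastVisit F ω a := by
  have hset : {s | s ≤ b ∧ ω s ∈ F} = {s | s ≤ a ∧ ω s ∈ F} := by
    ext s
    exact ⟨fun ⟨hsb, hs⟩ => ⟨le_of_not_ge fun has => h s ⟨has, hsb⟩ hs, hs⟩,
      fun ⟨hsa, hs⟩ => ⟨hsa.trans hab, hs⟩⟩
  rw [lastVisit, lastVisit, lastTime, lastTime, hset]

theorem lastVisit_eq_of_forall_eq [T2Space E] (hab : a < b) (ha : ω a ∈ F) (hb : ω b ∉ F)
    (h : ∀ s ∈ Ico a b, ω s = ω a) : lastVisit F ω b = ω a := by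
  have hlast : lastTime F ω b = b := by
    refine csSup_eq_of_forall_le_of_forall_lt_exists_gt ⟨a, hab.le, ha⟩ (fun s hs => hs.1)
      fun w hw => ?_
    obtain ⟨s, hs, hsb⟩ := exists_between (max_lt hw hab)
    have has : a ≤ s := (le_max_right w a).trans hs.le
    exact ⟨s, ⟨hsb.le, (h s ⟨has, hsb⟩).symm ▸ ha⟩, (le_max_left w a).trans_lt hs⟩
  rw [lastVisit, hlast, if_neg hb]
  have : (𝓝[<] b).NeBot := nhdsLT_neBot_of_exists_lt ⟨a, hab⟩
  refine leftLim_eq_of_tendsto (tendsto_nhds_of_eventually_eq ?_)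
  filter_upwards [Ico_mem_nhdsLT hab] with s hs using h s hs

/-- On `[0, T)`, the last visit of `ω` to a point of `F` begins at time `a`, when `ω` may already
be at that point, and ends at time `b`; the path stays outside of `F` on `[b, T)`. -/
structure IsLastSojourn (F : Set E) (ω : PathSpace E) (a b T : ℝ≥0) : Prop where
  lt : a < b
  le : b ≤ T
  mem : ω a ∈ F
  eq_start : ∀ s ∈ Ico a b, ω s = ω a
  notMem : ∀ s ∈ Ico b T, ω s ∉ F

namespace IsLastSojourn

theorem extend (h : IsLastSojourn F ω a b t) (htT : t ≤ T) (hT : ∀ s ∈ Ico t T, ω s ∉ F) :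
    IsLastSojourn F ω a b T where
  lt := h.lt
  le := h.le.trans htT
  mem := h.mem
  eq_start := h.eq_start
  notMem s hs := (lt_or_ge s t).elim (fun hst => h.notMem s ⟨hs.1, hst⟩) fun hts =>
    hT s ⟨hts, hs.2⟩

theorem lastVisit_eq_of_notMem [T2Space E] (h : IsLastSojourn F ω a b T) (ht : t ∈ Icc b T)
    (htF : ω t ∉ F) : lastVisit F ω t = ω a := by
  have hout : ∀ s ∈ Icc b t, ω s ∉ F := fun s hs => hs.2.eq_or_lt.elim (fun hst => hst ▸ htF)
    fun hst => h.notMem s ⟨hs.1, hst.trans_le ht.2⟩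
  rw [lastVisit_eq_of_forall_notMem ht.1 hout,
    lastVisit_eq_of_forall_eq h.lt h.mem (hout b ⟨le_rfl, ht.1⟩) h.eq_start]

theorem lastVisit_eq [T2Space E] (h : IsLastSojourn F ω a b T) (ht : t ∈ Ico a T) :
    lastVisit F ω t = ω a := by
  rcases lt_or_ge t b with htb | hbt
  · have hta : ω t = ω a := h.eq_start t ⟨ht.1, htb⟩
    rw [lastVisit_eq_self (hta ▸ h.mem), hta]
  · exact h.lastVisit_eq_of_notMem ⟨hbt, ht.2.le⟩ (h.notMem t ⟨hbt, ht.2⟩)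

end IsLastSojourn

variable [DiscreteTopology E]

theorem isCadlag_lastVisit (F : Set E) (ω : PathSpace E) : IsCadlag (lastVisit F ω) := by
  refine ω.2.of_forall_eqOn_Icc fun a b hab h => ?_
  by_cases ha : ω a ∈ F
  · have hba : ω b = ω a := h b ⟨hab, le_rfl⟩
    rw [lastVisit_eq_self ha, lastVisit_eq_self (hba ▸ ha), hba]
  · exact lastVisit_eq_of_forall_notMem hab fun s hs => (h s hs).symm ▸ ha

theorem lastSojourn_induction (h0 : ω 0 ∈ F) {p : ℝ≥0 → Prop} (zero : p 0)
    (step : ∀ {a b T}, IsLastSojourn F ω a b T → p a → p T) (T : ℝ≥0) : p T := by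
  suffices h : T = 0 ∨ ∃ a b, IsLastSojourn F ω a b T ∧ p a by
    rcases h with rfl | ⟨a, b, h, ha⟩
    exacts [zero, step h ha]
  refine cadlag_induction ω (p := fun T => T = 0 ∨ ∃ a b, IsLastSojourn F ω a b T ∧ p a)
    (.inl rfl) (fun c d hcd hc hω => .inr ?_) T
  by_cases hcF : ω c ∈ F
  · have hpc : p c := by
      rcases hc with rfl | ⟨a, b, h, ha⟩
      exacts [zero, step h ha]
    exact ⟨c, d, ⟨hcd, le_rfl, hcF, fun s hs => hω s hs.1 hs.2, by simp⟩, hpc⟩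
  · rcases hc with rfl | ⟨a, b, h, ha⟩
    · exact absurd h0 hcF
    · exact ⟨a, b, h.extend hcd.le fun s hs => (hω s hs.1 hs.2).symm ▸ hcF, ha⟩

theorem exists_isLastSojourn (h0 : ω 0 ∈ F) (hT : 0 < T) : ∃ a b, IsLastSojourn F ω a b T :=
  lastSojourn_induction h0 (p := fun T => 0 < T → ∃ a b, IsLastSojourn F ω a b T)
    (fun h => absurd h (lt_irrefl 0)) (fun h _ _ => ⟨_, _, h⟩) T hT

theorem exists_isLastSojourn_of_notMem (h0 : ω 0 ∈ F) (ht : ω t ∉ F) :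
    ∃ a b, IsLastSojourn F ω a b t ∧ lastVisit F ω t = ω a := by
  have hpos : 0 < t := pos_iff_ne_zero.2 fun h => ht (h ▸ h0)
  obtain ⟨a, b, h⟩ := exists_isLastSojourn h0 hpos
  exact ⟨a, b, h, h.lastVisit_eq_of_notMem ⟨h.le, le_rfl⟩ ht⟩

theorem lastVisit_mem (h0 : ω 0 ∈ F) (t : ℝ≥0) : lastVisit F ω t ∈ F := by
  by_cases ht : ω t ∈ F
  · rwa [lastVisit_eq_self ht]
  · obtain ⟨a, b, h, hlast⟩ := exists_isLastSojourn_of_notMem h0 ht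
    exact hlast ▸ h.mem

theorem lastVisit_eq_iff_dense (h0 : ω 0 ∈ F) {D : Set ℝ≥0} (hD : Dense D) (ht : t ∈ D) {v : E}
    (hv : v ∈ F) : lastVisit F ω t = v ↔ ∃ q ∈ D, q ≤ t ∧ ω q = v ∧
      ∀ r ∈ D, q < r → r ≤ t → ω r ∈ F → ω r = v := by
  by_cases htF : ω t ∈ F
  · rw [lastVisit_eq_self htF]
    refine ⟨fun h => ⟨t, ht, le_rfl, h, fun r _ htr hrt => absurd hrt htr.not_ge⟩, ?_⟩
    rintro ⟨q, -, hqt, hqv, h⟩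
    rcases hqt.eq_or_lt with rfl | hqt
    exacts [hqv, h t ht hqt le_rfl htF]
  · obtain ⟨a, b, hab, hlast⟩ := exists_isLastSojourn_of_notMem h0 htF
    rw [hlast]
    constructor
    · rintro rfl
      obtain ⟨q, hqD, haq, hqb⟩ := hD.exists_between hab.lt
      refine ⟨q, hqD, hqb.le.trans hab.le, hab.eq_start q ⟨haq.le, hqb⟩, fun r _ hqr hrt hr => ?_⟩
      refine hab.eq_start r ⟨(haq.trans hqr).le, lt_of_not_ge fun hbr => ?_⟩
      exact hab.notMem r ⟨hbr, hrt.lt_of_ne (by rintro rfl; exact htF hr)⟩ hr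
    · rintro ⟨q, -, hqt, rfl, h⟩
      have hqb : q < b := lt_of_not_ge fun hbq =>
        hab.notMem q ⟨hbq, hqt.lt_of_ne (by rintro rfl; exact htF hv)⟩ hv
      obtain ⟨r, hrD, hr, hrb⟩ := hD.exists_between (max_lt hab.lt hqb)
      have hra : ω r = ω a := hab.eq_start r ⟨(le_max_left a q).trans hr.le, hrb⟩
      rw [← hra]
      exact h r hrD ((le_max_right a q).trans_lt hr) (hrb.le.trans hab.le) (hra ▸ hab.mem)

theorem measurable_eval_lastVisit [Countable E] (F : Set E) (t : ℝ≥0) (s : Set E) :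
    MeasurableSet {ω : PathSpace E | ω 0 ∈ F ∧ lastVisit F ω t ∈ s} := by
  obtain ⟨D₀, hD₀c, hD₀⟩ := TopologicalSpace.exists_countable_dense ℝ≥0
  have hDc : (insert t D₀).Countable := hD₀c.insert t
  have hD : Dense (insert t D₀) := hD₀.mono (subset_insert t D₀)
  have hset : {ω : PathSpace E | ω 0 ∈ F ∧ lastVisit F ω t ∈ s} = {ω | ω 0 ∈ F} ∩
      ⋃ v ∈ F ∩ s, ⋃ q ∈ insert t D₀ ∩ Iic t, {ω | ω q ∈ ({v} : Set E)} ∩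
        ⋂ r ∈ insert t D₀ ∩ Ioc q t, {ω | ω r ∈ Fᶜ ∪ {v}} := by
    ext ω
    refine and_congr_right fun h0 => ?_
    have hiff : lastVisit F ω t ∈ s ↔ ∃ v ∈ F ∩ s, lastVisit F ω t = v :=
      ⟨fun hs => ⟨_, ⟨lastVisit_mem h0 t, hs⟩, rfl⟩, by rintro ⟨_, ⟨-, hs⟩, rfl⟩; exact hs⟩
    rw [hiff, mem_iUnion₂]
    simp only [exists_prop]
    refine exists_congr fun v => and_congr_right fun hv => ?_
    rw [lastVisit_eq_iff_dense h0 hD (mem_insert t D₀) hv.1]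
    simp only [mem_iUnion, mem_iInter, mem_inter_iff, mem_Iic, mem_Ioc, mem_ofPred_eq, mem_union,
      mem_compl_iff, mem_singleton_iff, exists_prop, and_imp, and_assoc, ← imp_iff_not_or]
  rw [hset]
  refine (measurableSet_eval 0 F).inter <| MeasurableSet.biUnion (to_countable _) fun v _ =>
    MeasurableSet.biUnion (hDc.mono inter_subset_left) fun q _ => ?_
  exact (measurableSet_eval q {v}).inter <|
    MeasurableSet.biInter (hDc.mono inter_subset_left) fun r _ => measurableSet_eval r _

theorem aemeasurable_ofFun_lastVisit [Countable E] {S : Type*} [TopologicalSpace S]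
    (Ψ : E → S) {μ : Measure (PathSpace E)} (h0 : ∀ᵐ ω ∂μ, ω 0 ∈ F) :
    AEMeasurable (fun ω => ofFun fun t => Ψ (lastVisit F ω t)) μ := by
  rw [← Measure.restrict_eq_self_of_ae_mem h0]
  refine aemeasurable_restrict_of_measurable_subtype (measurableSet_eval 0 F) <|
    PathSpace.measurable_of_eval fun t s => ?_
  refine ((measurable_eval_lastVisit F t (Ψ ⁻¹' s)).preimage measurable_subtype_coe).congr ?_
  ext ⟨ω, hω⟩
  simp only [mem_preimage, mem_ofPred_eq, ofFun_apply ((isCadlag_lastVisit F ω).comp_discrete Ψ)]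
  exact and_iff_right hω

end lastVisit

/-! ### The time change between the trace and the last-visit path -/

section timeChange

variable {E : Type*} [TopologicalSpace E] [DiscreteTopology E] {F : Set E} {ω : PathSpace E}
  {a b t T : ℝ≥0}

theorem IsLastSojourn.timeIn_eq (h : IsLastSojourn F ω a b T) :
    timeIn F ω T = timeIn F ω a + (b - a) := by
  rw [timeIn_of_notMem h.le h.notMem]
  exact timeIn_of_mem h.lt.le fun s hs => (h.eq_start s hs).symm ▸ h.mem

theorem IsLastSojourn.timeIn_compl_eq (h : IsLastSojourn F ω a b T) :
    timeIn Fᶜ ω T = timeIn Fᶜ ω a + (T - b) := by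
  rw [timeIn_of_mem h.le h.notMem, timeIn_of_notMem h.lt.le fun s hs =>
    not_not.2 ((h.eq_start s hs).symm ▸ h.mem)]

theorem IsLastSojourn.tracePath_eq (h : IsLastSojourn F ω a b T) {u : ℝ≥0} (hu : u < b - a) :
    tracePath F ω (timeIn F ω a + u) = ω a := by
  have hub : a + u < b := by rwa [add_comm, ← lt_tsub_iff_right]
  have hua : ω (a + u) = ω a := h.eq_start _ ⟨le_self_add, hub⟩
  have htime : timeIn F ω (a + u) = timeIn F ω a + u := by
    rw [timeIn_of_mem le_self_add fun s hs => (h.eq_start s ⟨hs.1, hs.2.trans hub⟩).symm ▸ h.mem,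
      add_tsub_cancel_left]
  rw [← htime, tracePath_timeIn (hua ▸ h.mem), hua]

/-- The time change `l` carries the trace on `F` of the path `ω`, up to the time spent in `F`
during `[0, T]`, to the last-visit path up to time `T`. It delays times, by at most the time spent
outside of `F`. -/
structure IsTraceTimeChange (F : Set E) (ω : PathSpace E) (T : ℝ≥0) (l : ℝ≥0 ≃o ℝ≥0) : Prop where
  map_timeIn : l (timeIn F ω T) = T
  self_le : ∀ s ≤ timeIn F ω T, s ≤ l s
  le_add : ∀ s ≤ timeIn F ω T, l s ≤ s + timeIn Fᶜ ω T
  lastVisit_eq : ∀ s < timeIn F ω T, lastVisit F ω (l s) = tracePath F ω s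

-- The sojourn `[a, b)` is stretched linearly over `[a, T)`.
theorem IsTraceTimeChange.exists_extend {l : ℝ≥0 ≃o ℝ≥0} (hl : IsTraceTimeChange F ω a l)
    (h : IsLastSojourn F ω a b T) : ∃ l', IsTraceTimeChange F ω T l' := by
  obtain ⟨d, hd⟩ : ∃ d, d = b - a := ⟨_, rfl⟩
  obtain ⟨e, he⟩ : ∃ e, e = T - b := ⟨_, rfl⟩
  have hdpos : 0 < d := hd ▸ tsub_pos_of_lt h.lt
  have hT : a + (d + e) = T := by
    rw [hd, he, ← add_assoc, add_tsub_cancel_of_le h.lt.le, add_tsub_cancel_of_le h.le]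
  obtain ⟨l', hleft, hright⟩ := exists_glue l (timeIn F ω a) (c := 1 + e / d) (by positivity)
  have hstretch (u : ℝ≥0) : l' (timeIn F ω a + u) = a + (u + e / d * u) := by
    rw [hright _ le_self_add, hl.map_timeIn, add_tsub_cancel_left, add_mul, one_mul]
  have htime : timeIn F ω T = timeIn F ω a + d := hd ▸ h.timeIn_eq
  have htimec : timeIn Fᶜ ω T = timeIn Fᶜ ω a + e := he ▸ h.timeIn_compl_eq
  have hmap : l' (timeIn F ω T) = T := by
    rw [htime, hstretch, div_mul_cancel₀ e hdpos.ne', hT]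
  refine ⟨l', hmap, fun s hs => ?_, fun s hs => ?_, fun s hs => ?_⟩ <;>
    rcases lt_or_ge s (timeIn F ω a) with hsa | hsa
  · exact hleft s hsa.le ▸ hl.self_le s hsa.le
  · obtain ⟨u, rfl⟩ := exists_add_of_le hsa
    rw [hstretch]
    exact add_le_add (timeIn_le F ω a) le_self_add
  · rw [hleft s hsa.le, htimec, ← add_assoc]
    exact (hl.le_add s hsa.le).trans le_self_add
  · obtain ⟨u, rfl⟩ := exists_add_of_le hsa
    have hud : u ≤ d := by rwa [htime, add_le_add_iff_left] at hs
    calc l' (timeIn F ω a + u) = timeIn F ω a + timeIn Fᶜ ω a + (u + e / d * u) := by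
          rw [hstretch, timeIn_add_compl]
      _ ≤ timeIn F ω a + timeIn Fᶜ ω a + (u + e / d * d) := by gcongr
      _ = timeIn F ω a + u + timeIn Fᶜ ω T := by
          rw [htimec, div_mul_cancel₀ e hdpos.ne']
          ring
  · rw [hleft s hsa.le, hl.lastVisit_eq s hsa]
  · obtain ⟨u, rfl⟩ := exists_add_of_le hsa
    have hud : u < b - a := by rwa [htime, add_lt_add_iff_left, hd] at hs
    have hlT : l' (timeIn F ω a + u) < T := (l'.strictMono hs).trans_eq hmap
    rw [h.tracePath_eq hud, h.lastVisit_eq ⟨(hstretch u).symm ▸ le_self_add, hlT⟩]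

theorem exists_isTraceTimeChange (h0 : ω 0 ∈ F) (T : ℝ≥0) : ∃ l, IsTraceTimeChange F ω T l := by
  refine lastSojourn_induction h0 (p := fun T => ∃ l, IsTraceTimeChange F ω T l) ?_
    (fun h ⟨l, hl⟩ => hl.exists_extend h) T
  refine ⟨OrderIso.refl ℝ≥0, ?_, fun s _ => le_rfl, fun s _ => le_self_add, fun s hs => ?_⟩
  · rw [timeIn_zero, OrderIso.refl_apply]
  · rw [timeIn_zero] at hs
    exact absurd hs not_lt_zero

theorem isCadlag_tracePath (h0 : ω 0 ∈ F) (hω : totalOccupationTime F ω = ∞) :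
    IsCadlag (tracePath F ω) := by
  refine IsCadlag.of_eventuallyEq fun t => ?_
  obtain ⟨T, hT⟩ := exists_lt_timeIn_of_totalOccupationTime_eq_top hω t
  obtain ⟨l, hl⟩ := exists_isTraceTimeChange h0 T
  refine ⟨_, (isCadlag_lastVisit F ω).comp_orderIso l, ?_⟩
  filter_upwards [Iio_mem_nhds hT] with s hs using (hl.lastVisit_eq s hs).symm

theorem ofFun_tracePath_lastVisit_mem_closePairs {S : Type*} [TopologicalSpace S] (Ψ : E → S)
    (h0 : ω 0 ∈ F) (hω : totalOccupationTime F ω = ∞) {M ε : ℝ≥0} (hε : ε ≤ 1)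
    (h : occupationTime Fᶜ (M + 1) ω < ε) :
    (ofFun fun t => Ψ (tracePath F ω t), ofFun fun t => Ψ (lastVisit F ω t)) ∈
      closePairs S M ε := by
  have hout : timeIn Fᶜ ω (M + 1) < ε := by
    rw [← coe_timeIn] at h
    exact_mod_cast h
  have hM : M < timeIn F ω (M + 1) := by
    refine lt_of_add_lt_add_right (a := timeIn Fᶜ ω (M + 1)) ?_
    rw [timeIn_add_compl]
    exact add_lt_add_right (hout.trans_le hε) M
  obtain ⟨l, hl⟩ := exists_isTraceTimeChange h0 (M + 1)
  refine ⟨l, fun t ht => ⟨?_, ?_⟩⟩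
  · have htl : t ≤ l t := hl.self_le t (ht.trans hM.le)
    rw [← NNReal.coe_sub htl, NNReal.abs_eq, NNReal.coe_lt_coe]
    exact (tsub_le_iff_left.2 (hl.le_add t (ht.trans hM.le))).trans_lt hout
  · simp only [ofFun_apply ((isCadlag_lastVisit F ω).comp_discrete Ψ),
      ofFun_apply ((isCadlag_tracePath h0 hω).comp_discrete Ψ),
      hl.lastVisit_eq t (ht.trans_lt hM)]

end timeChange

/-! ### Recurrence -/

section recurrence

variable {E : Type*} [TopologicalSpace E] {P : E → ProbabilityMeasure (PathSpace E)}

theorem HasJumpRates.exists_measure_eval_eq_pos [Fintype E] {R : E → E → ℝ≥0}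
    (hPR : HasJumpRates R P) {x y : E} (hxy : x ≠ y) (h : 0 < R x y) :
    ∃ s, 0 < (P x : Measure (PathSpace E)) {ω | ω s = y} := by
  classical
  by_contra! hnull
  have hint (t : ℝ) : ∫ ω, (if ω t.toNNReal = y then (1 : ℝ) else 0)
      ∂(P x : Measure (PathSpace E)) = 0 := by
    refine integral_eq_zero_of_ae ?_
    filter_upwards [measure_eq_zero_iff_ae_notMem.1 (le_zero_iff.1 (hnull t.toNNReal))] with ω hω
    exact if_neg hω
  have hrate : ∑ ξ, ((if ξ = y then (1 : ℝ) else 0) - if x = y then 1 else 0) * (R x ξ : ℝ) =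
      R x y := by
    simp [hxy]
  have hderiv := hPR (fun z => if z = y then 1 else 0) x
  simp only [hint, hrate] at hderiv
  have hzero : (R x y : ℝ) = 0 :=
    (uniqueDiffWithinAt_Ici 0).eq_deriv _ hderiv (hasDerivWithinAt_const _ _ _)
  exact h.ne' (by exact_mod_cast hzero)

theorem IsMarkovProcess.ae_eval_zero_mem (hP : IsMarkovProcess P) {F : Set E} {x : E}
    (hx : x ∈ F) : ∀ᵐ ω ∂(P x : Measure (PathSpace E)), ω 0 ∈ F :=
  (hP.start x).mono fun _ hω => hω.symm ▸ hx

variable [DiscreteTopology E] {F : Set E}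

theorem PathSpace.measurableSet_past_eval (s : ℝ≥0) (F : Set E) :
    MeasurableSet[past E s] {ω : PathSpace E | ω s ∈ F} :=
  (le_iSup₂ (f := fun (r : ℝ≥0) (_ : r ≤ s) => (borel E).comap fun ω : PathSpace E => ω r)
    s le_rfl) _ ⟨F, by rw [borel_eq_top_of_discrete]; trivial, rfl⟩

theorem IsMarkovProcess.measure_eval_add_mem_pos (hP : IsMarkovProcess P) {x y : E} {s t : ℝ≥0}
    (hxy : 0 < (P x : Measure (PathSpace E)) {ω | ω s = y})
    (hyF : 0 < (P y : Measure (PathSpace E)) {ω | ω t ∈ F}) :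
    0 < (P x : Measure (PathSpace E)) {ω | ω (s + t) ∈ F} :=
  calc 0 < (P y : Measure (PathSpace E)) {ω | ω t ∈ F} *
        (P x : Measure (PathSpace E)) {ω | ω s ∈ ({y} : Set E)} := ENNReal.mul_pos hyF.ne' hxy.ne'
    _ = ∫⁻ ω in {ω | ω s ∈ ({y} : Set E)}, (P (ω s) : Measure (PathSpace E)) {ω | ω t ∈ F}
        ∂(P x : Measure (PathSpace E)) := by
      rw [← setLIntegral_const]
      refine setLIntegral_congr_fun (measurableSet_eval s {y}) fun ω (hω : ω s = y) => ?_
      simp only [hω]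
    _ = (P x : Measure (PathSpace E)) ({ω | ω s ∈ ({y} : Set E)} ∩ shift s ⁻¹' {ω | ω t ∈ F}) :=
      (hP.markov x s _ _ (measurableSet_past_eval s {y}) (measurableSet_eval t F)).symm
    _ ≤ (P x : Measure (PathSpace E)) {ω | ω (s + t) ∈ F} := measure_mono inter_subset_right

theorem IsMarkovProcess.exists_measure_eval_mem_pos [Fintype E] {R : E → E → ℝ≥0}
    (hP : IsMarkovProcess P) (hPR : HasJumpRates R P) (hR : IsIrreducibleRates R)
    (hF : F.Nonempty) (x : E) : ∃ s, 0 < (P x : Measure (PathSpace E)) {ω | ω s ∈ F} := by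
  obtain ⟨z, hz⟩ := hF
  induction hR x z using Relation.ReflTransGen.head_induction_on with
  | refl =>
    exact ⟨0, pos_iff_ne_zero.2 (frequently_ae_iff.1 (hP.ae_eval_zero_mem hz).frequently)⟩
  | @head x y hxy _ ih =>
    rcases eq_or_ne x y with rfl | hne
    · exact ih
    · obtain ⟨s, hs⟩ := hPR.exists_measure_eval_eq_pos hne hxy
      obtain ⟨t, ht⟩ := ih
      exact ⟨s + t, hP.measure_eval_add_mem_pos hs ht⟩

variable [Finite E]

theorem IsMarkovProcess.measure_totalOccupationTime_eq_zero (hP : IsMarkovProcess P)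
    (hF : ∀ x, ∃ s, 0 < (P x : Measure (PathSpace E)) {ω | ω s ∈ F}) (x : E) :
    (P x : Measure (PathSpace E)) {ω | totalOccupationTime F ω = 0} = 0 := by
  have : Nonempty E := ⟨x⟩
  set C : Set (PathSpace E) := {ω | totalOccupationTime F ω = 0}
  have hC : MeasurableSet C := measurable_totalOccupationTime F (measurableSet_singleton 0)
  obtain ⟨z, hz⟩ := Finite.exists_max fun y => (P y : Measure (PathSpace E)) C
  obtain ⟨s, hs⟩ := hF z
  have hsub : C ⊆ {ω | ω s ∈ Fᶜ} ∩ shift s ⁻¹' C := fun ω hω =>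
    ⟨fun hF => (totalOccupationTime_pos hF).ne' hω,
      le_zero_iff.1 ((totalOccupationTime_shift_le s).trans_eq hω)⟩
  have hle : (P z : Measure (PathSpace E)) C ≤
      (P z : Measure (PathSpace E)) C * (P z : Measure (PathSpace E)) {ω | ω s ∈ Fᶜ} :=
    calc (P z : Measure (PathSpace E)) C
        ≤ (P z : Measure (PathSpace E)) ({ω | ω s ∈ Fᶜ} ∩ shift s ⁻¹' C) := measure_mono hsub
      _ = ∫⁻ ω in {ω | ω s ∈ Fᶜ}, (P (ω s) : Measure (PathSpace E)) C
          ∂(P z : Measure (PathSpace E)) := hP.markov z s _ C (measurableSet_past_eval s Fᶜ) hC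
      _ ≤ ∫⁻ _ in {ω | ω s ∈ Fᶜ}, (P z : Measure (PathSpace E)) C
          ∂(P z : Measure (PathSpace E)) := lintegral_mono fun ω => hz (ω s)
      _ = _ := setLIntegral_const _ _
  have hlt : (P z : Measure (PathSpace E)) {ω | ω s ∈ Fᶜ} < 1 :=
    calc (P z : Measure (PathSpace E)) {ω | ω s ∈ F}ᶜ
        = 1 - (P z : Measure (PathSpace E)) {ω | ω s ∈ F} :=
          prob_compl_eq_one_sub (measurableSet_eval s F)
      _ < 1 := ENNReal.sub_lt_self ENNReal.one_ne_top one_ne_zero hs.ne'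
  by_contra hne
  have hz0 : (P z : Measure (PathSpace E)) C ≠ 0 := ((pos_iff_ne_zero.2 hne).trans_le (hz x)).ne'
  exact hle.not_gt (by simpa using ENNReal.mul_lt_mul_right hz0 (measure_ne_top _ _) hlt)

theorem IsMarkovProcess.exists_forall_measure_totalOccupationTime_lt_le (hP : IsMarkovProcess P)
    (hF : ∀ x, ∃ s, 0 < (P x : Measure (PathSpace E)) {ω | ω s ∈ F}) {ε : ℝ≥0∞} (hε : 0 < ε) :
    ∃ δ > 0, ∀ x, (P x : Measure (PathSpace E)) {ω | totalOccupationTime F ω < δ} ≤ ε := by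
  have hlim (x : E) : ∀ᶠ δ in 𝓝[>] (0 : ℝ≥0∞),
      (P x : Measure (PathSpace E)) {ω | totalOccupationTime F ω < δ} < ε := by
    have hinter : ⋂ δ > (0 : ℝ≥0∞), {ω : PathSpace E | totalOccupationTime F ω < δ} =
        {ω | totalOccupationTime F ω = 0} := by
      ext ω
      simp only [gt_iff_lt, mem_iInter, mem_ofPred_eq]
      exact ⟨fun h => by_contra fun h0 => (h _ (pos_iff_ne_zero.2 h0)).false,
        fun h δ hδ => h.trans_lt hδ⟩
    have hcont := tendsto_measure_biInter_gt (μ := (P x : Measure (PathSpace E)))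
      (s := fun δ => {ω : PathSpace E | totalOccupationTime F ω < δ}) (a := (0 : ℝ≥0∞))
      (fun δ _ => (measurable_totalOccupationTime F measurableSet_Iio).nullMeasurableSet)
      (fun _ _ _ hij _ hω => lt_of_lt_of_le hω hij) ⟨1, one_pos, measure_ne_top _ _⟩
    rw [hinter, hP.measure_totalOccupationTime_eq_zero hF x] at hcont
    exact hcont.eventually_lt_const hε
  obtain ⟨δ, hPδ, hδ⟩ := ((eventually_all.2 hlim).and self_mem_nhdsWithin).exists
  exact ⟨δ, hδ, fun x => (hPδ x).le⟩

theorem IsMarkovProcess.ae_totalOccupationTime_eq_top (hP : IsMarkovProcess P)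
    (hF : ∀ x, ∃ s, 0 < (P x : Measure (PathSpace E)) {ω | ω s ∈ F}) (x : E) :
    ∀ᵐ ω ∂(P x : Measure (PathSpace E)), totalOccupationTime F ω = ∞ := by
  refine le_zero_iff.1 (le_of_forall_gt_imp_ge_of_dense fun ε hε => ?_)
  obtain ⟨δ, hδ, hPδ⟩ := hP.exists_forall_measure_totalOccupationTime_lt_le hF hε
  set C : Set (PathSpace E) := {ω | totalOccupationTime F ω < δ}
  have hC : MeasurableSet C := measurable_totalOccupationTime F measurableSet_Iio
  have hmono : Monotone fun t : ℝ≥0 => shift t ⁻¹' C := fun s t hst ω hω =>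
    (antitone_totalOccupationTime_shift F ω hst).trans_lt hω
  have hshift (t : ℝ≥0) : (P x : Measure (PathSpace E)) (shift t ⁻¹' C) ≤ ε :=
    calc (P x : Measure (PathSpace E)) (shift t ⁻¹' C)
        = ∫⁻ ω, (P (ω t) : Measure (PathSpace E)) C ∂(P x : Measure (PathSpace E)) := by
          simpa using hP.markov x t univ C .univ hC
      _ ≤ ∫⁻ _, ε ∂(P x : Measure (PathSpace E)) := lintegral_mono fun ω => hPδ (ω t)
      _ = ε := by simp
  calc (P x : Measure (PathSpace E)) {ω | totalOccupationTime F ω = ∞}ᶜ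
      ≤ (P x : Measure (PathSpace E)) (⋃ t : ℝ≥0, shift t ⁻¹' C) :=
        measure_mono fun ω hω => mem_iUnion.2 (exists_totalOccupationTime_shift_lt hω hδ)
    _ = ⨆ t : ℝ≥0, (P x : Measure (PathSpace E)) (shift t ⁻¹' C) := hmono.measure_iUnion
    _ ≤ ε := iSup_le hshift

end recurrence

/-! ### Converging together -/

section convergingTogether

variable {ι : Type*} {l : Filter ι} {Ω' : Type*} [MeasurableSpace Ω'] {ν : Measure Ω'}
  [IsProbabilityMeasure ν]

theorem tendstoInDistribution_of_tendsto_measure_notMem_entourage [l.IsCountablyGenerated]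
    {Ω : ι → Type*} [∀ i, MeasurableSpace (Ω i)] {μ : ∀ i, Measure (Ω i)}
    [∀ i, IsProbabilityMeasure (μ i)] {S : Type*} [UniformSpace S]
    [(𝓤 S).IsCountablyGenerated] [MeasurableSpace S] [OpensMeasurableSpace S]
    {X Y : ∀ i, Ω i → S} {Z : Ω' → S} (hX : TendstoInDistribution X l Z μ ν)
    (hY : ∀ i, AEMeasurable (Y i) (μ i))
    (hXY : ∀ V ∈ 𝓤 S, Tendsto (fun i => μ i {ω | (X i ω, Y i ω) ∉ V}) l (𝓝 0)) :
    TendstoInDistribution Y l Z μ ν := by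
  refine ⟨hY, hX.aemeasurable_limit, tendsto_of_forall_isClosed_limsup_le' fun C hC => ?_⟩
  let _ : PseudoMetricSpace S := UniformSpace.pseudoMetricSpace S
  change limsup (fun i => (μ i).map (Y i) C) l ≤ ν.map Z C
  have hthick (δ : ℝ) (hδ : 0 < δ) :
      limsup (fun i => (μ i).map (Y i) C) l ≤ ν.map Z (Metric.cthickening δ C) := by
    have hfar := hXY _ (edist_mem_uniformity (ENNReal.ofReal_pos.2 hδ))
    calc limsup (fun i => (μ i).map (Y i) C) l
        ≤ limsup (fun i => (μ i).map (X i) (Metric.cthickening δ C) +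
            μ i {ω | (X i ω, Y i ω) ∉ {p | edist p.1 p.2 < ENNReal.ofReal δ}}) l := by
          refine limsup_le_limsup (Eventually.of_forall fun i => ?_)
          beta_reduce
          rw [Measure.map_apply_of_aemeasurable (hY i) hC.measurableSet,
            Measure.map_apply_of_aemeasurable (hX.forall_aemeasurable i)
              Metric.isClosed_cthickening.measurableSet]
          refine (measure_mono fun ω hω => ?_).trans (measure_union_le _ _)
          exact or_iff_not_imp_right.2 fun h =>
            Metric.mem_cthickening_of_edist_le _ _ δ C hω (not_not.1 h).le
      _ = limsup (fun i => (μ i).map (X i) (Metric.cthickening δ C)) l :=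
          ENNReal.limsup_add_of_right_tendsto_zero hfar _
      _ ≤ ν.map Z (Metric.cthickening δ C) :=
          ProbabilityMeasure.limsup_measure_closed_le_of_tendsto hX.tendsto
            Metric.isClosed_cthickening
  have : IsProbabilityMeasure (ν.map Z) := Measure.isProbabilityMeasure_map hX.aemeasurable_limit
  have hlim := tendsto_measure_cthickening_of_isClosed (μ := ν.map Z)
    ⟨1, one_pos, measure_ne_top _ _⟩ hC
  exact ge_of_tendsto (hlim.mono_left (nhdsWithin_le_nhds (s := Ioi 0)))
    (eventually_nhdsWithin_of_forall hthick)

variable {S : Type*} [TopologicalSpace S] [DiscreteTopology S]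
  {E : ι → Type*} [∀ i, TopologicalSpace (E i)] [∀ i, DiscreteTopology (E i)]
  {μ : ∀ i, Measure (PathSpace (E i))} {F : ∀ i, Set (E i)}

theorem tendsto_measure_tracePath_lastVisit_notMem_uniformity (Ψ : ∀ i, E i → S)
    (hstart : ∀ i, ∀ᵐ ω ∂μ i, ω 0 ∈ F i)
    (htotal : ∀ i, ∀ᵐ ω ∂μ i, totalOccupationTime (F i) ω = ∞)
    (hocc : ∀ t, 0 < t → Tendsto (fun i => ∫⁻ ω, occupationTime (F i)ᶜ t ω ∂μ i) l (𝓝 0))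
    {V : Set (PathSpace S × PathSpace S)} (hV : V ∈ 𝓤 (PathSpace S)) :
    Tendsto (fun i => μ i {ω | (ofFun fun t => Ψ i (tracePath (F i) ω t),
      ofFun fun t => Ψ i (lastVisit (F i) ω t)) ∉ V}) l (𝓝 0) := by
  obtain ⟨⟨M, ε⟩, hε, hMV⟩ := hasBasis_uniformity.mem_iff.1 hV
  obtain ⟨δ, hδ0, hδ⟩ : ∃ δ : ℝ≥0, 0 < δ ∧ δ ≤ min ε.toNNReal 1 :=
    ⟨_, lt_min (Real.toNNReal_pos.2 hε) one_pos, le_rfl⟩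
  have hδε : (δ : ℝ) ≤ ε := (Real.le_toNNReal_iff_coe_le (le_of_lt hε)).1 (hδ.trans inf_le_left)
  have hlim : Tendsto (fun i => (∫⁻ ω, occupationTime (F i)ᶜ (M + 1) ω ∂μ i) / δ) l (𝓝 0) := by
    simpa using ENNReal.Tendsto.div_const (hocc (M + 1) (by positivity)) (b := (δ : ℝ≥0∞))
      (.inr (ENNReal.coe_ne_zero.2 hδ0.ne'))
  refine tendsto_of_tendsto_of_tendsto_of_le_of_le tendsto_const_nhds hlim (fun _ => zero_le)
    fun i => ?_
  calc μ i {ω | (ofFun fun t => Ψ i (tracePath (F i) ω t),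
          ofFun fun t => Ψ i (lastVisit (F i) ω t)) ∉ V}
      ≤ μ i {ω | (δ : ℝ≥0∞) ≤ occupationTime (F i)ᶜ (M + 1) ω} := by
        refine measure_mono_ae ?_
        filter_upwards [hstart i, htotal i] with ω h0 hω hnot
        refine not_lt.1 fun hlt => hnot (hMV (closePairs_mono le_rfl hδε ?_))
        exact ofFun_tracePath_lastVisit_mem_closePairs (Ψ i) h0 hω (hδ.trans inf_le_right) hlt
    _ ≤ (∫⁻ ω, occupationTime (F i)ᶜ (M + 1) ω ∂μ i) / δ :=
        meas_ge_le_lintegral_div (measurable_occupationTime _ _).aemeasurable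
          (ENNReal.coe_ne_zero.2 hδ0.ne') ENNReal.coe_ne_top

theorem mainTheorem5_general [l.IsCountablyGenerated] [Countable S] [∀ i, Countable (E i)]
    [∀ i, IsProbabilityMeasure (μ i)] (Ψ : ∀ i, E i → S) {Z : Ω' → PathSpace S}
    (hstart : ∀ i, ∀ᵐ ω ∂μ i, ω 0 ∈ F i)
    (htotal : ∀ i, ∀ᵐ ω ∂μ i, totalOccupationTime (F i) ω = ∞)
    (hocc : ∀ t, 0 < t → Tendsto (fun i => ∫⁻ ω, occupationTime (F i)ᶜ t ω ∂μ i) l (𝓝 0))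
    (htrace : TendstoInDistribution (fun i ω => ofFun fun t => Ψ i (tracePath (F i) ω t)) l Z μ ν) :
    TendstoInDistribution (fun i ω => ofFun fun t => Ψ i (lastVisit (F i) ω t)) l Z μ ν :=
  tendstoInDistribution_of_tendsto_measure_notMem_entourage htrace
    (fun i => aemeasurable_ofFun_lastVisit (Ψ i) (hstart i)) fun _ hV =>
      tendsto_measure_tracePath_lastVisit_notMem_uniformity Ψ hstart htotal hocc hV

end convergingTogether

theorem IsMetastable.tendsto_lintegral_occupationTime {κ : ℕ} [NeZero κ] {E : ℕ → Type*}
    [∀ N, TopologicalSpace (E N)] {P : ∀ N, E N → ProbabilityMeasure (PathSpace (E N))}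
    {𝓔 : ∀ N, Fin κ → Set (E N)} {Q : Fin κ → ProbabilityMeasure (PathSpace (Fin κ))}
    (hmeta : IsMetastable P 𝓔 Q) {η : ∀ N, E N} (hη : ∀ N, η N ∈ ⋃ x, 𝓔 N x) {t : ℝ≥0}
    (ht : 0 < t) :
    Tendsto (fun N => ∫⁻ ω, occupationTime (⋃ x, 𝓔 N x)ᶜ t ω
      ∂(P N (η N) : Measure (PathSpace (E N)))) atTop (𝓝 0) :=
  tendsto_of_tendsto_of_tendsto_of_le_of_le tendsto_const_nhds
    (hmeta.tendsto_occupationTime t ht) (fun _ => zero_le) fun N =>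
      le_iSup₂ (f := fun ξ (_ : ξ ∈ ⋃ x, 𝓔 N x) => ∫⁻ ω, occupationTime (⋃ x, 𝓔 N x)ᶜ t ω
        ∂(P N ξ : Measure (PathSpace (E N)))) (η N) (hη N)

theorem mainTheorem5 {κ : ℕ} [NeZero κ] {E : ℕ → Type*} [∀ N, Fintype (E N)]
    [∀ N, TopologicalSpace (E N)] [∀ N, DiscreteTopology (E N)]
    (R : ∀ N, E N → E N → ℝ≥0) (hR : ∀ N, IsIrreducibleRates (R N))
    (P : ∀ N, E N → ProbabilityMeasure (PathSpace (E N)))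
    (hP : ∀ N, IsMarkovProcess (P N)) (hPR : ∀ N, HasJumpRates (R N) (P N))
    (𝓔 : ∀ N, Fin κ → Set (E N)) (h𝓔 : ∀ N x y, x ≠ y → Disjoint (𝓔 N x) (𝓔 N y))
    (Q : Fin κ → ProbabilityMeasure (PathSpace (Fin κ)))
    (hmeta : IsMetastable P 𝓔 Q)
    (x : Fin κ) (η : ∀ N, E N) (hη : ∀ N, η N ∈ 𝓔 N x) :
    TendstoInDistribution (fun N => lastVisitProcess (𝓔 N)) atTop id
      (fun N => (P N (η N) : Measure (PathSpace (E N))))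
      (Q x : Measure (PathSpace (Fin κ))) := by
  have hmem (N : ℕ) : η N ∈ ⋃ y, 𝓔 N y := mem_iUnion.2 ⟨x, hη N⟩
  have hvisit (N : ℕ) := (hP N).exists_measure_eval_mem_pos (hPR N) (hR N) ⟨η N, hmem N⟩
  exact mainTheorem5_general (fun N => metaProj (𝓔 N)) (fun N => (hP N).ae_eval_zero_mem (hmem N))
    (fun N => (hP N).ae_totalOccupationTime_eq_top (hvisit N) (η N))
    (fun _ => hmeta.tendsto_lintegral_occupationTime hmem) (hmeta.tendsto_trace x η hη)
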